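/- **Model.** A UAV of mass $m_{UAV}>0$ and symmetric positive definite inertia matrix $H_{UAV}$ carries a rigidly attached payload of mass $m_{PL}\ge 0$ and symmetric positive semidefinite inertia matrix $H_{PL}$; gravity is $g>0$. In the body-fixed frame centred at the centre of gravity of the UAV alone, the payload is at $r_{PL}$ and the point of interest (POI) at $r_{POI}$. Put $m_{tot}=m_{UAV}+m_{PL}$, $\hat r=r_{POI}-\frac{m_{PL}}{m_{tot}}r_{PL}$ and $$\alpha=z_{POI}-\tfrac{m_{PL}}{m_{tot}}z_{PL}.$$ Let $S(a)b=a\times b$, let $R=R_z(\psi)R_y(\theta)R_x(\varphi)$ for Euler angles $\eta=(\varphi,\theta,\psi)$, and let $\omega=\Gamma(\eta)\dot\eta$ be the body-fixed angular velocity, with $\Gamma=\begin{pmatrix}1&0&-\sin\theta\\0&\cos\varphi&\sin\varphi\cos\theta\\0&-\sin\varphi&\cos\varphi\cos\theta\end{pmatrix}$. Let $p\in\mathbb R^3$ be the inertial position of the POI, $F=(T,\tau_\varphi,\tau_\theta,\tau_\psi)$ the input (thrust and torques), and put $H_{CoG}=\frac{m_{UAV}m_{PL}}{m_{tot}}S(r_{PL})^\top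 S(r_{PL})+H_{UAV}+H_{PL}$, $M_1=H_{CoG}+m_{tot}S(\hat r)^\top S(\hat r)$, $M_2=S(\hat r)S(\omega)-S(\omega)S(\hat r)$, $M_3=m_{tot}(\Gamma^{-\top}\otimes\dot p^\top)R_\eta S(\hat r)$, where $R_\eta$ stacks $\partial R/\partial\varphi,\partial R/\partial\theta,\partial R/\partial\psi$ vertically. The model is $$B_y\begin{pmatrix}\ddot p\\\dot\omega\end{pmatrix}+M_5=M_F F,\quad \dot\eta=\Gamma^{-1}\omega,\quad M_5=C_y\begin{pmatrix}\dot p\\\omega\end{pmatrix}+G_y,\quad M_F=\begin{pmatrix}Re_3&0\\0&I_3\end{pmatrix},$$ $$B_y=\begin{pmatrix}m_{tot}I_3&m_{tot}RS(\hat r)\\m_{tot}S(\hat r)^\top R^\top&M_1\end{pmatrix},\quad C_y=\begin{pmatrix}0&m_{tot}RS(\omega)S(\hat r)\\m_{tot}M_2R^\top&S(\omega)M_1-M_3\end{pmatrix},\quad G_y=\begin{pmatrix}m_{tot}g\,e_3\\m_{tot}g\,S(\hat r)^\top\Gamma e_3\end{pmatrix}.$$ The output is $(p,\omega_z)$. Let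 $M_4=\begin{pmatrix}I_3&0\\0&e_3^\top\end{pmatrix}B_y^{-1}$, so that $(\ddot p,\dot\omega_z)=M_4M_FF-M_4M_5$. The *zero dynamics* $\dot z=f_{zd}(z)$, $z=(\omega_x,\omega_y,\varphi,\theta,\psi)$, are the equations for $z$ obtained from the model with $p=\dot p=0$, $\omega_z=0$ under the input-output linearizing feedback $F=(M_4M_F)^{-1}M_4M_5$, which makes $\ddot p=0$ and $\dot\omega_z=0$. **Theorem.** 1. If $\alpha\ne0$, then $M_4M_F$ is invertible for every $\eta$, the origin (hover) is an equilibrium of the zero dynamics, $f_{zd}$ is differentiable there, and its Jacobian at the origin is $$J=\begin{pmatrix}0&0&-g/\alpha&0&0\\0&0&0&-g/\alpha&0\\1&0&0&0&0\\0&1&0&0&0\\0&0&0&0&0\end{pmatrix},$$ with eigenvalues, counted with multiplicity, $0,\ \sqrt{-g/\alpha},\ \sqrt{-g/\alpha},\ -\sqrt{-g/\alpha},\ -\sqrt{-g/\alpha}$. 2. If $\alpha<0$, then the origin is an unstable equilibrium (not Lyapunov stable) of the nonlinear zero dynamics $\dot z=f_{zd}(z)$. 3. If $\alpha\ge 0$,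 then the linearized zero dynamics are marginally stable, that is, the origin is Lyapunov stable but not asymptotically stable. For $\alpha>0$ this holds for $\dot z=Jz$. For every $\alpha\ge0$, including $\alpha=0$, where the linearizing feedback and $J$ do not exist, it holds for the zero-output dynamics of the linearized model: the model, with state $x=(\dot p,\omega,p,\eta)$, is differentiable at the equilibrium $x=0$, $F=(m_{tot}g,\ m_{tot}g\,S(\hat r)^\top e_3)$, and the dynamics in question consist of all state trajectories of its linearization there, for any input, along which the output $(p,\omega_z)$ vanishes identically. -/

import Mathlib

open Matrix Set Filter Topology

noncomputable section

namespace UAVPayload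

/-! ### Stability notions for autonomous differential inclusions `z' ∈ F z`, at the origin -/

section Stability

variable {E : Type*} [NormedAddCommGroup E] [NormedSpace ℝ E]

/-- The right-hand side of the ordinary differential equation `z' = f z`. -/
def ode (f : E → E) : E → Set E := fun z => {f z}

/-- `z` solves `z' ∈ F z` on the time interval `[0, T]`. -/
def IsSolution (F : E → Set E) (T : ℝ) (z : ℝ → E) : Prop :=
  ∀ t ∈ Icc 0 T, ∃ v ∈ F (z t), HasDerivWithinAt z v (Icc 0 T) t

/-- Lyapunov stability of the origin. -/
def LyapunovStable (F : E → Set E) : Prop :=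
  ∀ ε > 0, ∃ δ > 0, ∀ (T : ℝ) (z : ℝ → E), IsSolution F T z → ‖z 0‖ < δ →
    ∀ t ∈ Icc 0 T, ‖z t‖ < ε

/-- The origin is unstable: it is not Lyapunov stable. -/
def Unstable (F : E → Set E) : Prop := ¬ LyapunovStable F

/-- Local attractivity of the origin: solutions on `[0, ∞)` that start close enough to the origin
converge to it. -/
def Attractive (F : E → Set E) : Prop :=
  ∃ δ > 0, ∀ z : ℝ → E, (∀ T : ℝ, IsSolution F T z) → ‖z 0‖ < δ → Tendsto z atTop (𝓝 0)

/-- Marginal stability of the origin: Lyapunov stable, but not asymptotically stable. -/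
def MarginallyStable (F : E → Set E) : Prop := LyapunovStable F ∧ ¬ Attractive F

end Stability

/-! ### The multirotor UAV with a rigidly attached payload -/

/-- Vectors of `ℝ³`. -/
abbrev V3 : Type := Fin 3 → ℝ

/-- The third unit vector. -/
def e3 : V3 := ![0, 0, 1]

/-- The skew-symmetric matrix with `skew a *ᵥ b = a × b`. -/
def skew (a : V3) : Matrix (Fin 3) (Fin 3) ℝ :=
  !![0, -a 2, a 1;
     a 2, 0, -a 0;
     -a 1, a 0, 0]

/-- Physical parameters. Positions are in the body-fixed frame, whose origin is the centre of
gravity of the UAV without payload. -/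
structure Params where
  /-- gravitational acceleration -/
  g : ℝ
  /-- mass of the UAV without payload -/
  mUAV : ℝ
  /-- mass of the payload -/
  mPL : ℝ
  /-- inertia matrix of the UAV without payload -/
  HUAV : Matrix (Fin 3) (Fin 3) ℝ
  /-- inertia matrix of the payload -/
  HPL : Matrix (Fin 3) (Fin 3) ℝ
  /-- position of the point of interest -/
  rPOI : V3
  /-- position of the payload -/
  rPL : V3

/-- Euler angles `(φ, θ, ψ)` to rotation matrix (body to inertial frame), ZYX convention:
`R_z(ψ) R_y(θ) R_x(φ)`. -/
def rot (η : V3) : Matrix (Fin 3) (Fin 3) ℝ :=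
  !![Real.cos (η 2), -Real.sin (η 2), 0;
     Real.sin (η 2), Real.cos (η 2), 0;
     0, 0, 1] *
  !![Real.cos (η 1), 0, Real.sin (η 1);
     0, 1, 0;
     -Real.sin (η 1), 0, Real.cos (η 1)] *
  !![1, 0, 0;
     0, Real.cos (η 0), -Real.sin (η 0);
     0, Real.sin (η 0), Real.cos (η 0)]

/-- The matrix `Γ` with `ω = Γ η'` for the body-fixed angular velocity `ω`. -/
def Gam (η : V3) : Matrix (Fin 3) (Fin 3) ℝ :=
  !![1, 0, -Real.sin (η 1);
     0, Real.cos (η 0), Real.sin (η 0) * Real.cos (η 1);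
     0, -Real.sin (η 0), Real.cos (η 0) * Real.cos (η 1)]

/-- The partial derivatives of `rot` with respect to the three Euler angles, stacked into a
`9 × 3` matrix whose row `(i, a)` is row `a` of `∂R/∂ηᵢ`. -/
def rotPartials (η : V3) : Matrix (Fin 3 × Fin 3) (Fin 3) ℝ :=
  Matrix.of fun k b => deriv (fun s => rot (Function.update η k.1 s) k.2 b) (η k.1)

/-- States `(p', ω, p, η)`: velocity of the point of interest, body-fixed angular velocity,
position of the point of interest, Euler angles. -/
abbrev State : Type := V3 × V3 × V3 × V3

/-- Inputs `(T, τ_φ, τ_θ, τ_ψ)`: thrust and torques. -/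
abbrev Input : Type := Fin 4 → ℝ

namespace Params

variable (P : Params)

/-- Total mass. -/
def mtot : ℝ := P.mUAV + P.mPL

/-- `r̂ = r_POI - (m_PL / m_tot) r_PL`, the point of interest relative to the combined centre of
gravity, in the body-fixed frame. -/
def rhat : V3 := P.rPOI - (P.mPL / P.mtot) • P.rPL

/-- `α = z_POI - (m_PL / m_tot) z_PL`. -/
def α : ℝ := P.rPOI 2 - P.mPL / P.mtot * P.rPL 2

/-- Total inertia at the combined centre of gravity. -/
def HCoG : Matrix (Fin 3) (Fin 3) ℝ :=
  (P.mUAV * P.mPL / P.mtot) • ((skew P.rPL)ᵀ * skew P.rPL) + (P.HUAV + P.HPL)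

/-- The matrix `M₁`. -/
def M1 : Matrix (Fin 3) (Fin 3) ℝ := P.HCoG + P.mtot • ((skew P.rhat)ᵀ * skew P.rhat)

/-- The matrix `M₂`. -/
def M2 (ω : V3) : Matrix (Fin 3) (Fin 3) ℝ :=
  skew P.rhat * skew ω - skew ω * skew P.rhat

/-- The matrix `M₃ = m_tot (Γ⁻ᵀ ⊗ p'ᵀ) R_η S(r̂)`; the Kronecker product is written out. -/
def M3 (v η : V3) : Matrix (Fin 3) (Fin 3) ℝ :=
  P.mtot • ((Matrix.of fun (i : Fin 3) (k : Fin 3 × Fin 3) => ((Gam η)⁻¹)ᵀ i k.1 * v k.2) *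
    rotPartials η * skew P.rhat)

/-- The mass matrix `B_y`. -/
def By (η : V3) : Matrix (Fin 3 ⊕ Fin 3) (Fin 3 ⊕ Fin 3) ℝ :=
  Matrix.fromBlocks
    (P.mtot • (1 : Matrix (Fin 3) (Fin 3) ℝ)) (P.mtot • (rot η * skew P.rhat))
    (P.mtot • ((skew P.rhat)ᵀ * (rot η)ᵀ)) P.M1

/-- The Coriolis matrix `C_y`. -/
def Cy (v ω η : V3) : Matrix (Fin 3 ⊕ Fin 3) (Fin 3 ⊕ Fin 3) ℝ :=
  Matrix.fromBlocks
    0 (P.mtot • (rot η * skew ω * skew P.rhat))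
    (P.mtot • (P.M2 ω * (rot η)ᵀ)) (skew ω * P.M1 - P.M3 v η)

/-- The gravity vector `G_y`, from the potential energy `m_tot g e₃ᵀ (p - R r̂)`. -/
def Gy (η : V3) : Fin 3 ⊕ Fin 3 → ℝ :=
  Sum.elim ((P.mtot * P.g) • e3) ((P.mtot * P.g) • ((skew P.rhat)ᵀ *ᵥ (Gam η *ᵥ e3)))

/-- The bias vector `M₅ = C_y (p', ω) + G_y`. -/
def M5 (v ω η : V3) : Fin 3 ⊕ Fin 3 → ℝ :=
  P.Cy v ω η *ᵥ Sum.elim v ω + P.Gy η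

end Params

/-- The input matrix `M_F`: thrust along the third body axis, and torques. -/
def MF (η : V3) : Matrix (Fin 3 ⊕ Fin 3) (Fin 4) ℝ :=
  Matrix.fromRows
    !![(rot η *ᵥ e3) 0, 0, 0, 0;
       (rot η *ᵥ e3) 1, 0, 0, 0;
       (rot η *ᵥ e3) 2, 0, 0, 0]
    !![0, 1, 0, 0;
       0, 0, 1, 0;
       0, 0, 0, 1]

/-- Selects `(p'', ω_z')` from `(p'', ω')`. -/
def outSel : Matrix (Fin 4) (Fin 3 ⊕ Fin 3) ℝ :=
  Matrix.fromCols
    !![1, 0, 0;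
       0, 1, 0;
       0, 0, 1;
       0, 0, 0]
    !![0, 0, 0;
       0, 0, 0;
       0, 0, 0;
       0, 0, 1]

namespace Params

variable (P : Params)

/-- The accelerations `(p'', ω') = B_y⁻¹ (M_F F - M₅)`. -/
def accel (v ω η : V3) (F : Input) : Fin 3 ⊕ Fin 3 → ℝ :=
  (P.By η)⁻¹ *ᵥ (MF η *ᵥ F - P.M5 v ω η)

/-- The full nonlinear model `x' = f (x, F)`, with `x = (p', ω, p, η)`. -/
def model (q : State × Input) : State :=
  let v := q.1.1
  let ω := q.1.2.1
  let η := q.1.2.2.2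
  (fun i => P.accel v ω η q.2 (Sum.inl i),
   fun i => P.accel v ω η q.2 (Sum.inr i),
   v,
   (Gam η)⁻¹ *ᵥ ω)

/-- The matrix `M₄`. -/
def M4 (η : V3) : Matrix (Fin 4) (Fin 3 ⊕ Fin 3) ℝ := outSel * (P.By η)⁻¹

/-- The input-output linearizing feedback with desired value `a` of `(p'', ω_z')`. -/
def linearizingInput (v ω η : V3) (a : Fin 4 → ℝ) : Input :=
  (P.M4 η * MF η)⁻¹ *ᵥ (a + P.M4 η *ᵥ P.M5 v ω η)

/-- The vector field of the zero dynamics for the outputs `p` and `ω_z`, in the states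
`z = (ω_x, ω_y, φ, θ, ψ)`: the model with `p = p' = 0` and `ω_z = 0`, under the linearizing
feedback with desired `p'' = 0` and `ω_z' = 0`. -/
def zeroDyn (z : Fin 5 → ℝ) : Fin 5 → ℝ :=
  let ω : V3 := ![z 0, z 1, 0]
  let η : V3 := ![z 2, z 3, z 4]
  let a := P.accel 0 ω η (P.linearizingInput 0 ω η 0)
  let dη := (Gam η)⁻¹ *ᵥ ω
  ![a (Sum.inr 0), a (Sum.inr 1), dη 0, dη 1, dη 2]

/-- The Jacobian matrix of the zero dynamics at the origin. -/
def zeroDynJacobian : Matrix (Fin 5) (Fin 5) ℝ :=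
  !![0, 0, -P.g / P.α, 0, 0;
     0, 0, 0, -P.g / P.α, 0;
     1, 0, 0, 0, 0;
     0, 1, 0, 0, 0;
     0, 0, 0, 0, 0]

/-- The input that holds the hover state `x = 0`. -/
def hoverInput : Input :=
  Matrix.vecCons (P.mtot * P.g) ((P.mtot * P.g) • ((skew P.rhat)ᵀ *ᵥ e3))

/-- The output `(p, ω_z)` vanishes at the state `x`. -/
def OutputZero (x : State) : Prop := x.2.2.1 = 0 ∧ x.2.1 2 = 0

/-- The dynamics of the model linearized at hover, under the constraint that the output is
identically zero, with the (deviation of the) input free. It makes sense also for `α = 0`, where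
the linearizing feedback does not exist. -/
def constrainedLinearization (x : State) : Set State :=
  {w | OutputZero x ∧ ∃ u : Input, w = fderiv ℝ P.model (0, P.hoverInput) (x, u)}

end Params

end UAVPayload

end

/-! ### Rotation kinematics and the selection matrices -/

namespace UAVPayload

/-! Everything rests on the force balance in the body frame, `body_force_balance`. Its first two
rows contain neither thrust nor torques. With `p'' = 0` and `ω_z' = 0` they read `α ω_x' = ...` and
`α ω_y' = ...`, because the third coordinate of `r̂` is `α`. This makes the decoupling matrix `M₄
M_F` injective for `α ≠ 0`, and it gives the zero dynamics in closed form (`zeroDyn_eq`) without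
computing the feedback or inverting the mass matrix. The mass matrix itself is invertible because
its Schur complement is the positive definite `HCoG`.

To first order the zero dynamics are two copies of `α w' = -g φ`, `φ' = w`, for roll and pitch, and
a constant yaw.

For `α < 0` these are saddles. The function `V = ω_x φ + ω_y θ` satisfies `V' ≥ c V` near the origin
for the nonlinear field and is positive at points arbitrarily close to it, so Chetaev's criterion
(`unstable_of_chetaev`) applies.

For `α > 0` the energy `α w² + g φ²` is conserved and bounds solutions uniformly in time. For `α =
0` the same equation degenerates to the constraint `φ = 0`, hence `w = 0`. In both cases the yaw
axis is a line of equilibria, which excludes attractivity. For the linearized model the same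
oscillators come from differentiating the force balance at hover (`fderiv_model_spec`) and the
identities `p = 0`, `ω_z = 0` in time. -/

theorem skew_mulVec (a b : V3) : skew a *ᵥ b =
    ![a 1 * b 2 - a 2 * b 1, a 2 * b 0 - a 0 * b 2, a 0 * b 1 - a 1 * b 0] := by
  ext i
  fin_cases i <;> simp [skew, Matrix.mulVec, dotProduct, Fin.sum_univ_three] <;> ring

theorem rot_apply (η : V3) : rot η =
    !![Real.cos (η 2) * Real.cos (η 1),
       Real.cos (η 2) * Real.sin (η 1) * Real.sin (η 0) - Real.sin (η 2) * Real.cos (η 0),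
       Real.cos (η 2) * Real.sin (η 1) * Real.cos (η 0) + Real.sin (η 2) * Real.sin (η 0);
       Real.sin (η 2) * Real.cos (η 1),
       Real.sin (η 2) * Real.sin (η 1) * Real.sin (η 0) + Real.cos (η 2) * Real.cos (η 0),
       Real.sin (η 2) * Real.sin (η 1) * Real.cos (η 0) - Real.cos (η 2) * Real.sin (η 0);
       -Real.sin (η 1),
       Real.cos (η 1) * Real.sin (η 0),
       Real.cos (η 1) * Real.cos (η 0)] := by
  ext i j
  fin_cases i <;> fin_cases j <;>
    simp [rot, Matrix.mul_apply, Fin.sum_univ_three] <;> ring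

theorem rot_transpose_mul_rot (η : V3) : (rot η)ᵀ * rot η = 1 := by
  have h0 := Real.sin_sq_add_cos_sq (η 0)
  have h1 := Real.sin_sq_add_cos_sq (η 1)
  have h2 := Real.sin_sq_add_cos_sq (η 2)
  have orth : ∀ (s c : ℝ), s ^ 2 + c ^ 2 = 1 →
      (!![c, -s, 0; s, c, 0; 0, 0, 1] : Matrix (Fin 3) (Fin 3) ℝ)ᵀ *
        !![c, -s, 0; s, c, 0; 0, 0, 1] = 1 ∧
      (!![c, 0, s; 0, 1, 0; -s, 0, c] : Matrix (Fin 3) (Fin 3) ℝ)ᵀ *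
        !![c, 0, s; 0, 1, 0; -s, 0, c] = 1 ∧
      (!![1, 0, 0; 0, c, -s; 0, s, c] : Matrix (Fin 3) (Fin 3) ℝ)ᵀ *
        !![1, 0, 0; 0, c, -s; 0, s, c] = 1 := by
    intro s c h
    refine ⟨?_, ?_, ?_⟩ <;> ext i j <;> fin_cases i <;> fin_cases j <;>
      simp [Matrix.mul_apply, Fin.sum_univ_three] <;> linarith
  unfold rot
  rw [Matrix.transpose_mul, Matrix.transpose_mul]
  have hz := (orth _ _ h2).1
  have hy := (orth _ _ h1).2.1
  have hx := (orth _ _ h0).2.2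
  generalize !![Real.cos (η 2), -Real.sin (η 2), 0; Real.sin (η 2), Real.cos (η 2), 0; 0, 0, 1]
    = Z at hz ⊢
  generalize !![Real.cos (η 1), 0, Real.sin (η 1); 0, 1, 0; -Real.sin (η 1), 0, Real.cos (η 1)]
    = Y at hy ⊢
  rw [Matrix.mul_assoc, Matrix.mul_assoc, ← Matrix.mul_assoc Zᵀ, ← Matrix.mul_assoc Zᵀ, hz,
    Matrix.one_mul, ← Matrix.mul_assoc Yᵀ, hy, Matrix.one_mul, hx]

/-- Both sides are the inertial vertical seen from the body. This matches the gravity term of `Gy`,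
written with `Γ`, to the rotated force balance, and it shows that yaw does not enter. -/
theorem rot_transpose_mulVec_e3 (η : V3) : (rot η)ᵀ *ᵥ e3 = Gam η *ᵥ e3 := by
  rw [rot_apply]
  ext i
  fin_cases i <;> simp [Gam, e3, Matrix.mulVec, dotProduct, Fin.sum_univ_three] <;> ring

theorem rot_mulVec_eq_iff (η a b : V3) : rot η *ᵥ a = b ↔ a = (rot η)ᵀ *ᵥ b := by
  have h := rot_transpose_mul_rot η
  constructor
  · rintro rfl
    rw [Matrix.mulVec_mulVec, h, Matrix.one_mulVec]
  · rintro rfl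
    rw [Matrix.mulVec_mulVec, mul_eq_one_comm.mp h, Matrix.one_mulVec]

theorem det_Gam (η : V3) : (Gam η).det = Real.cos (η 1) := by
  have h0 := Real.sin_sq_add_cos_sq (η 0)
  simp [Gam, Matrix.det_fin_three]
  linear_combination Real.cos (η 1) * h0

theorem Gam_inv_mulVec (η ω : V3) (h : Real.cos (η 1) ≠ 0) : (Gam η)⁻¹ *ᵥ ω =
    ![ω 0 + (ω 1 * Real.sin (η 0) + ω 2 * Real.cos (η 0)) * Real.sin (η 1) / Real.cos (η 1),
      ω 1 * Real.cos (η 0) - ω 2 * Real.sin (η 0),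
      (ω 1 * Real.sin (η 0) + ω 2 * Real.cos (η 0)) / Real.cos (η 1)] := by
  have h0 := Real.sin_sq_add_cos_sq (η 0)
  have hdet : IsUnit (Gam η).det := by rw [det_Gam]; exact h.isUnit
  have : ω = Gam η *ᵥ
      ![ω 0 + (ω 1 * Real.sin (η 0) + ω 2 * Real.cos (η 0)) * Real.sin (η 1) / Real.cos (η 1),
        ω 1 * Real.cos (η 0) - ω 2 * Real.sin (η 0),
        (ω 1 * Real.sin (η 0) + ω 2 * Real.cos (η 0)) / Real.cos (η 1)] := by
    ext i
    fin_cases i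
    · simp [Gam, Matrix.mulVec, dotProduct, Fin.sum_univ_three]
      field_simp
      ring
    · simp [Gam, Matrix.mulVec, dotProduct, Fin.sum_univ_three]
      field_simp
      linear_combination -(ω 1) * h0
    · simp [Gam, Matrix.mulVec, dotProduct, Fin.sum_univ_three]
      field_simp
      linear_combination -(ω 2) * h0
  conv_lhs => rw [this]
  rw [Matrix.mulVec_mulVec, Matrix.nonsing_inv_mul _ hdet, Matrix.one_mulVec]

theorem MF_mulVec (η : V3) (F : Input) :
    MF η *ᵥ F = Sum.elim (F 0 • (rot η *ᵥ e3)) (Matrix.vecTail F) := by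
  ext i
  rcases i with i | i <;> fin_cases i <;>
    simp [MF, Matrix.mulVec, dotProduct, Fin.sum_univ_four, Matrix.vecTail, mul_comm]

theorem outSel_mulVec (y : Fin 3 ⊕ Fin 3 → ℝ) :
    outSel *ᵥ y = ![y (Sum.inl 0), y (Sum.inl 1), y (Sum.inl 2), y (Sum.inr 2)] := by
  ext i
  fin_cases i <;> simp [outSel, Matrix.mulVec, dotProduct, Fin.sum_univ_three]

/-! ### Mass matrix, balance laws and closed form of the zero dynamics -/

namespace Params

variable {P : Params}

theorem rhat_two (P : Params) : P.rhat 2 = P.α := by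
  simp [rhat, α]

theorem mtot_pos (hmU : 0 < P.mUAV) (hmP : 0 ≤ P.mPL) : 0 < P.mtot :=
  add_pos_of_pos_of_nonneg hmU hmP

theorem HCoG_posDef (hmU : 0 < P.mUAV) (hmP : 0 ≤ P.mPL)
    (hHU : P.HUAV.PosDef) (hHP : P.HPL.PosSemidef) : P.HCoG.PosDef := by
  have hm := mtot_pos hmU hmP
  unfold HCoG
  refine Matrix.PosDef.posSemidef_add ?_ (hHU.add_posSemidef hHP)
  refine Matrix.PosSemidef.smul ?_ (by positivity)
  exact Matrix.posSemidef_conjTranspose_mul_self (skew P.rPL)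

theorem isUnit_HCoG (hmU : 0 < P.mUAV) (hmP : 0 ≤ P.mPL)
    (hHU : P.HUAV.PosDef) (hHP : P.HPL.PosSemidef) : IsUnit P.HCoG.det :=
  (HCoG_posDef hmU hmP hHU hHP).det_pos.ne'.isUnit

theorem By_mulVec (η a w : V3) : P.By η *ᵥ Sum.elim a w =
    Sum.elim (P.mtot • a + P.mtot • (rot η *ᵥ (skew P.rhat *ᵥ w)))
      (P.mtot • ((skew P.rhat)ᵀ *ᵥ ((rot η)ᵀ *ᵥ a)) + P.M1 *ᵥ w) := by
  simp only [By, Matrix.fromBlocks_mulVec, Sum.elim_comp_inl, Sum.elim_comp_inr,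
    Matrix.smul_mulVec, Matrix.one_mulVec, Matrix.mulVec_mulVec]

/-- Block elimination: the rotational part of the mass matrix equation, taken at the centre of
gravity. -/
theorem HCoG_mulVec_of_By {η a w b c : V3} (h : P.By η *ᵥ Sum.elim a w = Sum.elim b c) :
    P.mtot • (a + rot η *ᵥ (skew P.rhat *ᵥ w)) = b ∧
      P.HCoG *ᵥ w = c - (skew P.rhat)ᵀ *ᵥ ((rot η)ᵀ *ᵥ b) := by
  rw [By_mulVec, Sum.elim_eq_iff] at h
  obtain ⟨h1, h2⟩ := h
  refine ⟨by rw [← h1, smul_add], ?_⟩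
  rw [← h1, ← h2, M1, Matrix.add_mulVec, Matrix.smul_mulVec, Matrix.mulVec_add,
    Matrix.mulVec_smul, Matrix.mulVec_smul, Matrix.mulVec_mulVec _ (rot η)ᵀ,
    rot_transpose_mul_rot, Matrix.one_mulVec, Matrix.mulVec_add, Matrix.mulVec_smul,
    Matrix.mulVec_smul, ← Matrix.mulVec_mulVec]
  abel

/-- A kernel vector has rotational part killed by the Schur complement `HCoG`, hence zero; its
translational part then vanishes as well. -/
theorem isUnit_det_By (hm : P.mtot ≠ 0) (hH : IsUnit P.HCoG.det) (η : V3) :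
    IsUnit (P.By η).det := by
  rw [isUnit_iff_ne_zero]
  intro hdet
  obtain ⟨y, hy, h0⟩ := Matrix.exists_mulVec_eq_zero_iff.mpr hdet
  apply hy
  rw [← Sum.elim_comp_inl_inr y] at h0 ⊢
  obtain ⟨h1, h2⟩ := HCoG_mulVec_of_By (b := 0) (c := 0) (by rw [h0]; ext i; cases i <;> rfl)
  have hw : y ∘ Sum.inr = 0 := by
    by_contra hne
    exact hH.ne_zero (Matrix.exists_mulVec_eq_zero_iff.mp ⟨_, hne, by simpa using h2⟩)
  rw [hw] at h1 ⊢
  have ha : y ∘ Sum.inl = 0 := by simpa [hm] using h1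
  rw [ha]
  ext i
  cases i <;> rfl

theorem By_mulVec_accel (hm : P.mtot ≠ 0) (hH : IsUnit P.HCoG.det) (v ω η : V3) (F : Input) :
    P.By η *ᵥ P.accel v ω η F = MF η *ᵥ F - P.M5 v ω η := by
  rw [accel, Matrix.mulVec_mulVec, Matrix.mul_nonsing_inv _ (isUnit_det_By hm hH η),
    Matrix.one_mulVec]

theorem M5_eq (P : Params) (v ω η : V3) : P.M5 v ω η =
    Sum.elim (P.mtot • (rot η *ᵥ (skew ω *ᵥ (skew P.rhat *ᵥ ω))) + (P.mtot * P.g) • e3)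
      (P.mtot • (P.M2 ω *ᵥ ((rot η)ᵀ *ᵥ v)) + (skew ω *ᵥ (P.M1 *ᵥ ω) - P.M3 v η *ᵥ ω) +
        (P.mtot * P.g) • ((skew P.rhat)ᵀ *ᵥ (Gam η *ᵥ e3))) := by
  rw [M5, Cy, Gy, Matrix.fromBlocks_mulVec]
  simp only [Sum.elim_comp_inl, Sum.elim_comp_inr, Matrix.zero_mulVec, zero_add,
    Matrix.smul_mulVec, Matrix.mulVec_mulVec, Matrix.sub_mulVec, Matrix.mul_assoc]
  ext i
  cases i <;> rfl

/-- Force balance in the inertial frame and moment balance at the centre of gravity. -/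
theorem accel_equations (hm : P.mtot ≠ 0) (hH : IsUnit P.HCoG.det) (v ω η : V3) (F : Input) :
    P.mtot • (P.accel v ω η F ∘ Sum.inl +
        rot η *ᵥ (skew P.rhat *ᵥ (P.accel v ω η F ∘ Sum.inr))) =
      F 0 • (rot η *ᵥ e3) -
        (P.mtot • (rot η *ᵥ (skew ω *ᵥ (skew P.rhat *ᵥ ω))) + (P.mtot * P.g) • e3) ∧
    P.HCoG *ᵥ (P.accel v ω η F ∘ Sum.inr) =
      Matrix.vecTail F -
        (P.mtot • (P.M2 ω *ᵥ ((rot η)ᵀ *ᵥ v)) + (skew ω *ᵥ (P.M1 *ᵥ ω) - P.M3 v η *ᵥ ω) +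
          (P.mtot * P.g) • ((skew P.rhat)ᵀ *ᵥ (Gam η *ᵥ e3))) -
        (skew P.rhat)ᵀ *ᵥ ((rot η)ᵀ *ᵥ (F 0 • (rot η *ᵥ e3) -
          (P.mtot • (rot η *ᵥ (skew ω *ᵥ (skew P.rhat *ᵥ ω))) + (P.mtot * P.g) • e3))) := by
  apply HCoG_mulVec_of_By
  rw [Sum.elim_comp_inl_inr, By_mulVec_accel hm hH, MF_mulVec, M5_eq]
  ext i
  cases i <;> rfl

/-- Force balance in the body-fixed frame, where only the attitude relative to gravity enters. -/
theorem body_force_balance (hm : P.mtot ≠ 0) (hH : IsUnit P.HCoG.det) (v ω η : V3) (F : Input) :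
    (rot η)ᵀ *ᵥ (P.accel v ω η F ∘ Sum.inl) + skew P.rhat *ᵥ (P.accel v ω η F ∘ Sum.inr) =
      (F 0 / P.mtot) • e3 - skew ω *ᵥ (skew P.rhat *ᵥ ω) - P.g • (Gam η *ᵥ e3) := by
  have h := congrArg (fun y => P.mtot⁻¹ • ((rot η)ᵀ *ᵥ y)) (accel_equations hm hH v ω η F).1
  simpa only [Matrix.mulVec_smul, Matrix.mulVec_add, Matrix.mulVec_sub, Matrix.mulVec_mulVec _ _ᵀ,
    rot_transpose_mul_rot, Matrix.one_mulVec, rot_transpose_mulVec_e3, smul_smul, smul_sub,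
    smul_add, inv_mul_cancel₀ hm, inv_mul_cancel_left₀ hm, one_smul, inv_mul_eq_div,
    mul_div_cancel_left₀ _ hm, sub_sub] using h

/-- An input in the kernel produces `p'' = 0` and `ω_z' = 0`, so `m_tot S(r̂) ω'` is a multiple of
`e3`. Its first two rows are `∓ α` times `ω_y'` and `ω_x'`, up to the mass, so `ω' = 0`; then the
thrust and the torques vanish in turn. -/
theorem isUnit_det_M4_mul_MF (hm : P.mtot ≠ 0) (hH : IsUnit P.HCoG.det) (hα : P.α ≠ 0) (η : V3) :
    IsUnit (P.M4 η * MF η).det := by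
  rw [isUnit_iff_ne_zero]
  intro hdet
  obtain ⟨F, hF, h0⟩ := Matrix.exists_mulVec_eq_zero_iff.mpr hdet
  apply hF
  rw [M4, Matrix.mul_assoc, ← Matrix.mulVec_mulVec, outSel_mulVec] at h0
  set y := ((P.By η)⁻¹ * MF η) *ᵥ F with hy
  have hBy : P.By η *ᵥ y = MF η *ᵥ F := by
    rw [hy, Matrix.mulVec_mulVec, Matrix.mul_nonsing_inv_cancel_left _ _ (isUnit_det_By hm hH η)]
  have ha : y ∘ Sum.inl = 0 := by
    ext i
    fin_cases i
    exacts [congrFun h0 0, congrFun h0 1, congrFun h0 2]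
  have hw2 : y (Sum.inr 2) = 0 := congrFun h0 3
  rw [← Sum.elim_comp_inl_inr y, MF_mulVec, By_mulVec, Sum.elim_eq_iff, ha] at hBy
  obtain ⟨h1, h2⟩ := hBy
  have h3 : P.mtot • (skew P.rhat *ᵥ (y ∘ Sum.inr)) = F 0 • e3 := by
    rw [smul_zero, zero_add, ← Matrix.mulVec_smul, rot_mulVec_eq_iff, Matrix.mulVec_smul,
      Matrix.mulVec_mulVec, rot_transpose_mul_rot, Matrix.one_mulVec] at h1
    exact h1
  rw [skew_mulVec] at h3
  have hw1 : y (Sum.inr 1) = 0 := by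
    have := congrFun h3 0
    simpa [e3, hw2, hm, rhat_two, hα] using this
  have hw0 : y (Sum.inr 0) = 0 := by
    have := congrFun h3 1
    simpa [e3, hw2, hm, rhat_two, hα] using this
  have hF0 : F 0 = 0 := by
    have := congrFun h3 2
    simpa [e3, hw0, hw1] using this.symm
  have hw : y ∘ Sum.inr = 0 := by
    ext i
    fin_cases i
    exacts [hw0, hw1, hw2]
  rw [hw] at h2
  simp only [Matrix.mulVec_zero, smul_zero, add_zero] at h2
  ext i
  refine Fin.cases hF0 (fun j => ?_) i
  exact (congrFun h2 j).symm

theorem accel_linearizingInput (hm : P.mtot ≠ 0) (hH : IsUnit P.HCoG.det) (hα : P.α ≠ 0)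
    (v ω η : V3) (a : Fin 4 → ℝ) :
    outSel *ᵥ P.accel v ω η (P.linearizingInput v ω η a) = a := by
  have hdet := isUnit_det_M4_mul_MF hm hH hα η
  rw [accel, Matrix.mulVec_mulVec, ← M4, Matrix.mulVec_sub, linearizingInput,
    Matrix.mulVec_mulVec, Matrix.mulVec_mulVec, Matrix.mul_nonsing_inv _ hdet,
    Matrix.one_mulVec, add_sub_cancel_right]

/-- The feedback matters only through `p'' = 0` and `ω_z' = 0`. The force balance then determines
`ω_x'` from row 1 and `ω_y'` from row 0; the unknown thrust appears only in row 2, and the inertia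
nowhere. -/
theorem zeroDyn_eq (hm : P.mtot ≠ 0) (hH : IsUnit P.HCoG.det) (hα : P.α ≠ 0)
    (z : Fin 5 → ℝ) (hz : Real.cos (z 3) ≠ 0) :
    P.zeroDyn z =
      ![-(P.g * (Real.sin (z 2) * Real.cos (z 3)) + P.rhat 1 * z 0 ^ 2 -
            P.rhat 0 * (z 0 * z 1)) / P.α,
        (P.rhat 0 * z 1 ^ 2 - P.rhat 1 * (z 0 * z 1) - P.g * Real.sin (z 3)) / P.α,
        z 0 + z 1 * Real.sin (z 2) * Real.sin (z 3) / Real.cos (z 3),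
        z 1 * Real.cos (z 2),
        z 1 * Real.sin (z 2) / Real.cos (z 3)] := by
  have hout := accel_linearizingInput hm hH hα 0 ![z 0, z 1, 0] ![z 2, z 3, z 4] 0
  have hbal := body_force_balance hm hH 0 ![z 0, z 1, 0] ![z 2, z 3, z 4]
    (P.linearizingInput 0 ![z 0, z 1, 0] ![z 2, z 3, z 4] 0)
  have hGam := Gam_inv_mulVec ![z 2, z 3, z 4] ![z 0, z 1, 0] hz
  simp only [zeroDyn, hGam]
  set y := P.accel 0 ![z 0, z 1, 0] ![z 2, z 3, z 4]
    (P.linearizingInput 0 ![z 0, z 1, 0] ![z 2, z 3, z 4] 0)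
  rw [outSel_mulVec] at hout
  have ha : y ∘ Sum.inl = 0 := by
    ext i
    fin_cases i
    exacts [congrFun hout 0, congrFun hout 1, congrFun hout 2]
  have hw2 : y (Sum.inr 2) = 0 := congrFun hout 3
  rw [ha, Matrix.mulVec_zero, zero_add] at hbal
  have h0 := congrFun hbal 0
  have h1 := congrFun hbal 1
  simp [Gam, e3, Matrix.mulVec, dotProduct, Fin.sum_univ_three, hw2,
    rhat_two, skew] at h0 h1
  ext i
  fin_cases i
  · simp
    field_simp
    linear_combination h1
  · simp
    field_simp
    linear_combination -h0
  · simp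
  · simp
  · simp

end Params

/-! ### Existence and confinement of solutions, Chetaev's criterion -/

section Ode

variable {E : Type*} [NormedAddCommGroup E] [NormedSpace ℝ E]

theorem IsSolution.mono {F : E → Set E} {S T : ℝ} {z : ℝ → E} (h : IsSolution F T z)
    (hST : S ≤ T) : IsSolution F S z := fun t ht => by
  obtain ⟨v, hv, hd⟩ := h t ⟨ht.1, ht.2.trans hST⟩
  exact ⟨v, hv, hd.mono (Icc_subset_Icc_right hST)⟩

theorem IsSolution.continuousOn {F : E → Set E} {T : ℝ} {z : ℝ → E} (h : IsSolution F T z) :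
    ContinuousOn z (Icc 0 T) := fun t ht => by
  obtain ⟨v, -, hd⟩ := h t ht
  exact hd.continuousWithinAt

/-- A bounded Lipschitz vector field has solutions on every time interval. -/
theorem exists_isSolution_of_bounded [CompleteSpace E] {f : E → E} {K L : NNReal}
    (hf : LipschitzWith K f) (hb : ∀ x, ‖f x‖ ≤ L) {T : ℝ} (hT : 0 ≤ T) (x : E) :
    ∃ z : ℝ → E, z 0 = x ∧ IsSolution (ode f) T z := by
  -- At speed at most `L` a solution stays within distance `L * T` of `x`, so this radius costs no
  -- restriction on `T`.
  have hPL : IsPicardLindelof (fun _ => f) (⟨0, le_refl 0, hT⟩ : Icc (0 : ℝ) T) x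
      (L * T.toNNReal) 0 L K :=
    .of_time_independent (fun y _ => hb y) (hf.lipschitzOnWith) (by simp [hT])
  obtain ⟨z, hz0, hz⟩ := hPL.exists_eq_forall_mem_Icc_hasDerivWithinAt₀
  exact ⟨z, hz0, fun t ht => ⟨_, rfl, hz t ht⟩⟩

/-- If `f` agrees with `h` on the closed ball of radius `ρ` and the origin is stable for `f`, then
solutions for `h` starting close to the origin never leave the open ball. -/
theorem LyapunovStable.norm_lt_of_eqOn {f h : E → E} (hs : LyapunovStable (ode f)) {ρ : ℝ}
    (hρ : 0 < ρ) (heq : EqOn h f (Metric.closedBall 0 ρ)) :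
    ∃ δ > 0, ∀ (T : ℝ) (z : ℝ → E), IsSolution (ode h) T z → ‖z 0‖ < δ →
      ∀ t ∈ Icc 0 T, ‖z t‖ < ρ := by
  obtain ⟨δ, hδ, hstab⟩ := hs ρ hρ
  -- Starting inside the `ρ`-ball makes the first exit time `t₁` below positive. Up to `t₁` the
  -- curve also solves the equation for `f`, so stability forbids the exit.
  refine ⟨min δ ρ, lt_min hδ hρ, fun T z hz h0 => ?_⟩
  have hcont : ContinuousOn (fun t => ‖z t‖) (Icc 0 T) := hz.continuousOn.norm
  by_contra! hex
  have hcomp : IsCompact {t ∈ Icc 0 T | ρ ≤ ‖z t‖} := by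
    refine isCompact_Icc.of_isClosed_subset ?_ (sep_subset _ _)
    exact hcont.preimage_isClosed_of_isClosed isClosed_Icc isClosed_Ici
  obtain ⟨t₁, ⟨ht₁, hle⟩, hmin⟩ := hcomp.exists_isLeast hex
  have hpos : 0 < t₁ := by
    refine lt_of_le_of_ne ht₁.1 ?_
    rintro rfl
    exact absurd (h0.trans_le (min_le_right _ _)) hle.not_gt
  have hlt : ∀ t ∈ Ico 0 t₁, ‖z t‖ ≤ ρ := fun t ht => by
    by_contra! hgt
    exact (hmin ⟨⟨ht.1, ht.2.le.trans ht₁.2⟩, hgt.le⟩).not_gt ht.2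
  have hle' : ∀ t ∈ Icc 0 t₁, ‖z t‖ ≤ ρ := by
    rw [← closure_Ico hpos.ne]
    exact fun t ht => le_on_closure hlt
      (by rw [closure_Ico hpos.ne]; exact hcont.mono (Icc_subset_Icc_right ht₁.2))
      continuousOn_const ht
  have hsol : IsSolution (ode f) t₁ z := fun t ht => by
    obtain ⟨v, rfl, hv⟩ := hz.mono ht₁.2 t ht
    exact ⟨_, heq (by simpa using hle' t ht), hv⟩
  exact (hstab t₁ z hsol (h0.trans_le (min_le_left _ _)) t₁ ⟨hpos.le, le_rfl⟩).not_ge hle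

end Ode

/-- Projection onto the closed ball of radius `ρ` for the supremum norm. -/
noncomputable def clamp {ι : Type*} (ρ : ℝ) (hρ : 0 ≤ ρ) (x : ι → ℝ) : ι → ℝ :=
  fun i => projIcc (-ρ) ρ (by linarith) (x i)

section Clamp

variable {ι : Type*} [Fintype ι] {ρ : ℝ} (hρ : 0 ≤ ρ)

theorem clamp_mem_closedBall (x : ι → ℝ) : clamp ρ hρ x ∈ Metric.closedBall 0 ρ := by
  rw [mem_closedBall_zero_iff, pi_norm_le_iff_of_nonneg hρ]
  exact fun i => abs_le.mpr (projIcc (-ρ) ρ (by linarith) (x i)).2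

theorem clamp_of_mem {x : ι → ℝ} (hx : x ∈ Metric.closedBall 0 ρ) : clamp ρ hρ x = x := by
  rw [mem_closedBall_zero_iff, pi_norm_le_iff_of_nonneg hρ] at hx
  ext i
  simp only [clamp]
  rw [projIcc_of_mem (by linarith) (abs_le.mp (hx i))]

theorem lipschitzWith_clamp : LipschitzWith 1 (clamp ρ hρ : (ι → ℝ) → ι → ℝ) := by
  refine LipschitzWith.of_dist_le_mul fun x y => ?_
  rw [NNReal.coe_one, one_mul, dist_pi_le_iff dist_nonneg]
  intro i
  have h := (LipschitzWith.projIcc (a := -ρ) (b := ρ) (by linarith)).dist_le_mul (x i) (y i)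
  rw [NNReal.coe_one, one_mul] at h
  exact h.trans (dist_le_pi_dist x y i)

end Clamp

/-- Chetaev's instability criterion. -/
theorem unstable_of_chetaev {ι : Type*} [Fintype ι] {f : (ι → ℝ) → ι → ℝ} {V : (ι → ℝ) → ℝ}
    {c : ℝ} (hc : 0 < c) (hf : ContDiffAt ℝ 1 f 0) (hV : Differentiable ℝ V)
    (hgrow : ∀ᶠ x in 𝓝 0, c * V x ≤ fderiv ℝ V x (f x)) (hpos : ∃ᶠ x in 𝓝 0, 0 < V x) :
    Unstable (ode f) := by
  intro hs
  obtain ⟨K, s, hsn, hlip⟩ := hf.exists_lipschitzOnWith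
  obtain ⟨ρ, hρ, hball⟩ := Metric.nhds_basis_closedBall.mem_iff.mp (inter_mem hsn hgrow)
  -- Stability speaks only of solutions that exist, so refuting it requires one on a long interval.
  -- Composing with the nonexpansive projection makes the field globally Lipschitz and bounded,
  -- without changing it on the ball.
  have hlip' : LipschitzWith K (f ∘ clamp ρ hρ.le) := by
    have h := (hlip.mono fun x hx => (hball hx).1).comp
      (lipschitzWith_clamp hρ.le).lipschitzOnWith (s := univ)
      fun x _ => clamp_mem_closedBall hρ.le x
    rwa [mul_one, lipschitzOnWith_univ] at h
  have hcpt : IsCompact (Metric.closedBall (0 : ι → ℝ) ρ) := isCompact_closedBall 0 ρ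
  obtain ⟨L, hL⟩ := hcpt.exists_bound_of_continuousOn
    (hlip.mono fun x hx => (hball hx).1).continuousOn
  obtain ⟨M, hM⟩ := hcpt.exists_bound_of_continuousOn hV.continuous.continuousOn
  obtain ⟨δ, hδ, hstay⟩ := hs.norm_lt_of_eqOn hρ
    (h := f ∘ clamp ρ hρ.le) fun x hx => by rw [Function.comp_apply, clamp_of_mem hρ.le hx]
  obtain ⟨x, hVx, hxδ⟩ := (hpos.and_eventually (Metric.ball_mem_nhds 0 hδ)).exists
  rw [dist_zero_right] at hxδ
  -- By time `T` the exponential growth of `V` would exceed its bound `M` on the ball, which the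
  -- solution never leaves.
  obtain ⟨T, hT0, hT⟩ : ∃ T : ℝ, 0 ≤ T ∧ M < V x * Real.exp (c * T) := by
    have : Tendsto (fun T => V x * Real.exp (c * T)) atTop atTop :=
      (Real.tendsto_exp_atTop.comp (tendsto_id.const_mul_atTop hc)).const_mul_atTop hVx
    exact ((eventually_ge_atTop 0).and (this.eventually_gt_atTop M)).exists
  obtain ⟨z, rfl, hz⟩ := exists_isSolution_of_bounded (L := L.toNNReal) hlip'
    (fun y => (hL _ (clamp_mem_closedBall hρ.le y)).trans (Real.le_coe_toNNReal L)) hT0 x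
  have hmem : ∀ t ∈ Icc 0 T, z t ∈ Metric.closedBall 0 ρ := fun t ht => by
    simpa using (hstay T z hz hxδ t ht).le
  -- The derivative is `(V' - c V) e^{-ct}`, nonnegative by `hgrow`.
  have hmono : MonotoneOn (fun t => V (z t) * Real.exp (-(c * t))) (Icc 0 T) := by
    refine monotoneOn_of_hasDerivWithinAt_nonneg (convex_Icc 0 T)
      (f' := fun t => fderiv ℝ V (z t) (f (z t)) * Real.exp (-(c * t)) +
        V (z t) * (Real.exp (-(c * t)) * -(c * 1)))
      ((hV.continuous.comp_continuousOn hz.continuousOn).mul (by fun_prop)) ?_ ?_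
    · intro t ht
      have ht' := interior_subset ht
      obtain ⟨v, rfl, hv⟩ := hz t ht'
      rw [Function.comp_apply, clamp_of_mem hρ.le (hmem t ht')] at hv
      have hv' := hv.mono (interior_subset (s := Icc 0 T))
      refine ((hV (z t)).hasFDerivAt.comp_hasDerivWithinAt t hv').mul ?_
      exact (((hasDerivAt_id t).const_mul c).neg.exp).hasDerivWithinAt
    · intro t ht
      have := (hball (hmem t (interior_subset ht))).2
      have hexp := Real.exp_pos (-(c * t))
      have : 0 ≤ (fderiv ℝ V (z t) (f (z t)) - c * V (z t)) * Real.exp (-(c * t)) :=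
        mul_nonneg (sub_nonneg.mpr this) hexp.le
      linarith
  have h := hmono ⟨le_rfl, hT0⟩ ⟨hT0, le_rfl⟩ hT0
  have hle : V (z T) ≤ M := (le_abs_self _).trans (hM _ (hmem T ⟨hT0, le_rfl⟩))
  simp only [mul_zero, neg_zero, Real.exp_zero, mul_one, Real.exp_neg] at h
  rw [← div_eq_mul_inv, le_div_iff₀ (Real.exp_pos _)] at h
  linarith

/-! ### Jacobian, spectrum and instability of the zero dynamics -/

namespace Params

variable {P : Params}

theorem eventually_cos_pitch_ne_zero : ∀ᶠ z : Fin 5 → ℝ in 𝓝 0, Real.cos (z 3) ≠ 0 := by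
  have : Continuous fun z : Fin 5 → ℝ => Real.cos (z 3) := by fun_prop
  exact this.continuousAt.eventually_ne (by simp)

theorem contDiffAt_zeroDyn (hm : P.mtot ≠ 0) (hH : IsUnit P.HCoG.det) (hα : P.α ≠ 0) :
    ContDiffAt ℝ 1 P.zeroDyn 0 := by
  refine ContDiffAt.congr_of_eventuallyEq ?_
    (eventually_cos_pitch_ne_zero.mono fun z hz => zeroDyn_eq hm hH hα z hz)
  have hc : Real.cos ((0 : Fin 5 → ℝ) 3) ≠ 0 := by simp
  rw [contDiffAt_pi]
  intro i
  fin_cases i <;> simp <;> fun_prop (disch := first | assumption | simp)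

theorem hasFDerivAt_zeroDyn (hm : P.mtot ≠ 0) (hH : IsUnit P.HCoG.det) (hα : P.α ≠ 0) :
    HasFDerivAt P.zeroDyn
      (LinearMap.toContinuousLinearMap (Matrix.mulVecLin P.zeroDynJacobian)) 0 := by
  have hd := ((contDiffAt_zeroDyn hm hH hα).differentiableAt one_ne_zero).hasFDerivAt
  refine hd.congr_fderiv ?_
  ext1 h
  -- Differentiability is already known, so derivatives along lines through the origin identify the
  -- Jacobian.
  have hline : HasDerivAt (fun t : ℝ => t • h) h 0 := by
    simpa using (hasDerivAt_id (0 : ℝ)).smul_const h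
  have hcomp : HasDerivAt (fun t : ℝ => P.zeroDyn (t • h)) (fderiv ℝ P.zeroDyn 0 h) 0 :=
    hd.comp_hasDerivAt_of_eq 0 hline (zero_smul ℝ h).symm
  refine hcomp.unique ?_
  have hev : ∀ᶠ t : ℝ in 𝓝 0, Real.cos ((t • h) 3) ≠ 0 := by
    have := hline.continuousAt.tendsto
    rw [zero_smul] at this
    exact this.eventually eventually_cos_pitch_ne_zero
  refine HasDerivAt.congr_of_eventuallyEq ?_
    (hev.mono fun t ht => zeroDyn_eq hm hH hα (t • h) ht)
  have hi : ∀ i, HasDerivAt (fun t : ℝ => (t • h) i) (h i) 0 := hasDerivAt_pi.mp hline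
  have hc : Real.cos (((0 : ℝ) • h) 3) ≠ 0 := by simp
  rw [hasDerivAt_pi]
  intro i
  fin_cases i
  · refine (((((hi 2).sin.mul (hi 3).cos).const_mul P.g).add
      (((hi 0).pow 2).const_mul (P.rhat 1))).sub
      (((hi 0).mul (hi 1)).const_mul (P.rhat 0))).neg.div_const P.α |>.congr_deriv ?_
    simp [zeroDynJacobian, Matrix.mulVec, dotProduct, Fin.sum_univ_five]
    ring
  · refine (((((hi 1).pow 2).const_mul (P.rhat 0)).sub
      (((hi 0).mul (hi 1)).const_mul (P.rhat 1))).sub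
      ((hi 3).sin.const_mul P.g)).div_const P.α |>.congr_deriv ?_
    simp [zeroDynJacobian, Matrix.mulVec, dotProduct, Fin.sum_univ_five]
    ring
  · refine (hi 0).add ((((hi 1).mul (hi 2).sin).mul (hi 3).sin).div (hi 3).cos hc)
      |>.congr_deriv ?_
    simp [zeroDynJacobian, Matrix.mulVec, dotProduct, Fin.sum_univ_five]
  · refine ((hi 1).mul (hi 2).cos).congr_deriv ?_
    simp [zeroDynJacobian, Matrix.mulVec, dotProduct, Fin.sum_univ_five]
  · refine (((hi 1).mul (hi 2).sin).div (hi 3).cos hc).congr_deriv ?_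
    simp [zeroDynJacobian, Matrix.mulVec, dotProduct, Fin.sum_univ_five]

open Polynomial in
-- Writing the entries `-g/α` as `s ^ 2` makes the characteristic polynomial split as `X (X - s)² (X
-- + s)²`, whether `s` is real or imaginary.
theorem roots_charpoly_zeroDynJacobian (P : Params) (s : ℂ)
    (hs : s ^ 2 = ((-P.g / P.α : ℝ) : ℂ)) :
    (P.zeroDynJacobian.map (fun r : ℝ => (r : ℂ))).charpoly.roots = {0, s, s, -s, -s} := by
  have hmap : P.zeroDynJacobian.map (fun r : ℝ => (r : ℂ)) =
      !![0, 0, s ^ 2, 0, 0; 0, 0, 0, s ^ 2, 0; 1, 0, 0, 0, 0; 0, 1, 0, 0, 0; 0, 0, 0, 0, 0] := by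
    rw [hs]
    ext i j
    fin_cases i <;> fin_cases j <;> simp [zeroDynJacobian]
  have hchar : Matrix.charmatrix (!![0, 0, s ^ 2, 0, 0; 0, 0, 0, s ^ 2, 0; 1, 0, 0, 0, 0;
      0, 1, 0, 0, 0; 0, 0, 0, 0, 0] : Matrix (Fin 5) (Fin 5) ℂ) =
      !![X, 0, -C s ^ 2, 0, 0; 0, X, 0, -C s ^ 2, 0; -1, 0, X, 0, 0; 0, -1, 0, X, 0;
        0, 0, 0, 0, X] := by
    ext i j : 2
    fin_cases i <;> fin_cases j <;> simp
  rw [hmap, Matrix.charpoly, hchar]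
  convert Polynomial.roots_multiset_prod_X_sub_C ({0, s, s, -s, -s} : Multiset ℂ)
  simp [Matrix.det_succ_row_zero, Fin.sum_univ_succ, Fin.succAbove]
  ring

theorem unstable_zeroDyn (hg : 0 < P.g) (hm : P.mtot ≠ 0) (hH : IsUnit P.HCoG.det)
    (hα : P.α < 0) : Unstable (ode P.zeroDyn) := by
  have hk : 0 < -P.g / P.α := div_pos_of_neg_of_neg (by linarith) hα
  set k := -P.g / P.α with hkdef
  set V : (Fin 5 → ℝ) → ℝ := fun z => z 0 * z 2 + z 1 * z 3 with hV
  have hVd : ∀ z, HasFDerivAt V _ z := fun z =>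
    ((hasFDerivAt_apply (𝕜 := ℝ) (0 : Fin 5) z).mul (hasFDerivAt_apply (2 : Fin 5) z)).add
      ((hasFDerivAt_apply (1 : Fin 5) z).mul (hasFDerivAt_apply (3 : Fin 5) z))
  have hmin : 0 < min (k / 2) (1 / 4) := by positivity
  -- Near the origin `V' ≥ (k/2)(φ² + θ²) + (1/4)(ω_x² + ω_y²)`: half of each square survives, and
  -- the cross term takes another quarter of the `ω` squares. The factor 2 comes from `2xy ≤ x² +
  -- y²`.
  refine unstable_of_chetaev (V := V) (c := 2 * min (k / 2) (1 / 4)) (by positivity)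
    (contDiffAt_zeroDyn hm hH hα.ne) (fun z => (hVd z).differentiableAt) ?_ ?_
  · have hlarge : ∀ {u : (Fin 5 → ℝ) → ℝ}, ContinuousAt u 0 → u 0 = 1 →
        ∀ᶠ z in 𝓝 0, 1 / 2 < u z := fun hu h1 =>
      hu.eventually (lt_mem_nhds (by rw [h1]; norm_num))
    have h1 := hlarge (u := fun z => Real.sinc (z 2) * Real.cos (z 3))
      ((Real.continuous_sinc.comp (continuous_apply 2)).mul (by fun_prop)).continuousAt (by simp)
    have h2 := hlarge (u := fun z => Real.sinc (z 3))
      (Real.continuous_sinc.comp (continuous_apply 3)).continuousAt (by simp)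
    have h3 := hlarge (u := fun z => 1 - P.rhat 1 * z 2 / P.α)
      (continuous_const.sub (((continuous_apply 2).const_mul _).div_const _)).continuousAt (by simp)
    have h4 := hlarge (u := fun z => Real.cos (z 2) + P.rhat 0 * z 3 / P.α)
      (by fun_prop (disch := exact hα.ne)) (by simp)
    have h5 : ∀ᶠ z : Fin 5 → ℝ in 𝓝 0, |Real.sin (z 2) * Real.sin (z 3) / Real.cos (z 3) +
        (P.rhat 0 * z 2 - P.rhat 1 * z 3) / P.α| < 1 / 2 := by
      have hcont : ContinuousAt (fun z : Fin 5 → ℝ =>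
          |Real.sin (z 2) * Real.sin (z 3) / Real.cos (z 3) +
            (P.rhat 0 * z 2 - P.rhat 1 * z 3) / P.α|) 0 := by
        have hc : Real.cos ((0 : Fin 5 → ℝ) 3) ≠ 0 := by simp
        fun_prop (disch := first | assumption | exact hα.ne)
      exact hcont.eventually (gt_mem_nhds (by simp))
    have hsinc : ∀ x, Real.sin x = x * Real.sinc x := fun x => by
      rcases eq_or_ne x 0 with rfl | hx
      · simp
      · rw [Real.sinc_of_ne_zero hx]
        field_simp
    filter_upwards [eventually_cos_pitch_ne_zero, h1, h2, h3, h4, h5] with z hz h1 h2 h3 h4 h5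
    rw [(hVd z).fderiv, zeroDyn_eq hm hH hα.ne z hz]
    set S := Real.sin (z 2) * Real.sin (z 3) / Real.cos (z 3) +
        (P.rhat 0 * z 2 - P.rhat 1 * z 3) / P.α with hS
    have hα' := hα.ne
    -- `V'` as a quadratic form in `(ω_x, ω_y, φ, θ)` with variable coefficients. At the origin they
    -- are `1, 1, k, k` on the diagonal and `0` for the cross term `S`; `sinc` extracts the factor
    -- `x` from `sin x`.
    have expand : k * z 2 ^ 2 * (Real.sinc (z 2) * Real.cos (z 3)) +
        k * z 3 ^ 2 * Real.sinc (z 3) + z 0 ^ 2 * (1 - P.rhat 1 * z 2 / P.α) +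
        z 1 ^ 2 * (Real.cos (z 2) + P.rhat 0 * z 3 / P.α) + z 0 * z 1 * S =
        z 0 * (z 0 + z 1 * Real.sin (z 2) * Real.sin (z 3) / Real.cos (z 3)) +
        z 2 * (-(P.g * (Real.sin (z 2) * Real.cos (z 3)) + P.rhat 1 * z 0 ^ 2 -
            P.rhat 0 * (z 0 * z 1)) / P.α) +
        (z 1 * (z 1 * Real.cos (z 2)) +
        z 3 * ((P.rhat 0 * z 1 ^ 2 - P.rhat 1 * (z 0 * z 1) - P.g * Real.sin (z 3)) / P.α)) := by
      have e2 := hsinc (z 2)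
      have e3 := hsinc (z 3)
      have e2' : z 2 ^ 2 * Real.sinc (z 2) = z 2 * Real.sin (z 2) := by rw [e2]; ring
      have e3' : z 3 ^ 2 * Real.sinc (z 3) = z 3 * Real.sin (z 3) := by rw [e3]; ring
      calc
        _ = k * (z 2 ^ 2 * Real.sinc (z 2)) * Real.cos (z 3) +
            k * (z 3 ^ 2 * Real.sinc (z 3)) + z 0 ^ 2 * (1 - P.rhat 1 * z 2 / P.α) +
            z 1 ^ 2 * (Real.cos (z 2) + P.rhat 0 * z 3 / P.α) + z 0 * z 1 * S := by ring
        _ = _ := by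
          rw [e2', e3', hS, hkdef]
          field_simp
          ring
    refine le_of_le_of_eq ?_ (expand.trans (by simp))
    have b1 : k / 2 * z 2 ^ 2 ≤ k * z 2 ^ 2 * (Real.sinc (z 2) * Real.cos (z 3)) := by
      nlinarith [mul_nonneg hk.le (sq_nonneg (z 2))]
    have b2 : k / 2 * z 3 ^ 2 ≤ k * z 3 ^ 2 * Real.sinc (z 3) := by
      nlinarith [mul_nonneg hk.le (sq_nonneg (z 3))]
    have b3 : z 0 ^ 2 / 2 ≤ z 0 ^ 2 * (1 - P.rhat 1 * z 2 / P.α) := by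
      nlinarith [sq_nonneg (z 0)]
    have b4 : z 1 ^ 2 / 2 ≤ z 1 ^ 2 * (Real.cos (z 2) + P.rhat 0 * z 3 / P.α) := by
      nlinarith [sq_nonneg (z 1)]
    have b5 : -((z 0 ^ 2 + z 1 ^ 2) / 4) ≤ z 0 * z 1 * S := by
      obtain ⟨hl, hu⟩ := abs_lt.mp h5
      nlinarith [mul_nonneg (by linarith : 0 ≤ 1 / 2 + S) (sq_nonneg (z 0 + z 1)),
        mul_nonneg (by linarith : 0 ≤ 1 / 2 - S) (sq_nonneg (z 0 - z 1))]
    have hmk := min_le_left (k / 2) (1 / 4 : ℝ)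
    have hmq := min_le_right (k / 2) (1 / 4 : ℝ)
    simp only [hV]
    generalize min (k / 2) (1 / 4 : ℝ) = m at *
    nlinarith [mul_nonneg (sub_nonneg.mpr hmk) (add_nonneg (sq_nonneg (z 2)) (sq_nonneg (z 3))),
      mul_nonneg (sub_nonneg.mpr hmq) (add_nonneg (sq_nonneg (z 0)) (sq_nonneg (z 1))),
      mul_nonneg hmin.le (add_nonneg (sq_nonneg (z 0 - z 2)) (sq_nonneg (z 1 - z 3)))]
  -- On this ray `V = t²`.
  · have hline : Tendsto (fun t : ℝ => (![t, 0, t, 0, 0] : Fin 5 → ℝ)) (𝓝[>] 0) (𝓝 0) := by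
      refine Tendsto.mono_left ?_ nhdsWithin_le_nhds
      have hc : Continuous fun t : ℝ => (![t, 0, t, 0, 0] : Fin 5 → ℝ) := by fun_prop
      convert hc.tendsto 0
      ext i
      fin_cases i <;> rfl
    refine hline.frequently (Eventually.frequently ?_)
    filter_upwards [self_mem_nhdsWithin] with t ht
    simpa [hV] using ht.ne'

end Params

/-! ### Oscillators and marginal stability of the linearized zero dynamics -/

/-- Conservation of energy for the oscillator `a w' = -b φ`, `φ' = w`. -/
theorem oscillator_energy {a b T : ℝ} {w φ : ℝ → ℝ}
    (hw : ∀ t ∈ Icc 0 T, ∃ d, HasDerivWithinAt w d (Icc 0 T) t ∧ a * d = -b * φ t)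
    (hφ : ∀ t ∈ Icc 0 T, HasDerivWithinAt φ (w t) (Icc 0 T) t) :
    ∀ t ∈ Icc 0 T, a * w t ^ 2 + b * φ t ^ 2 = a * w 0 ^ 2 + b * φ 0 ^ 2 := by
  have hd : ∀ t ∈ Icc 0 T,
      HasDerivWithinAt (fun t => a * w t ^ 2 + b * φ t ^ 2) 0 (Icc 0 T) t := fun t ht => by
    obtain ⟨d, hd, hwd⟩ := hw t ht
    refine (((hd.pow 2).const_mul a).add (((hφ t ht).pow 2).const_mul b)).congr_deriv ?_
    simp
    linear_combination 2 * w t * hwd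
  refine constant_of_derivWithin_zero (fun t ht => (hd t ht).differentiableWithinAt) fun t ht => ?_
  exact (hd t (Ico_subset_Icc_self ht)).derivWithin
    (uniqueDiffOn_Icc (ht.1.trans_lt ht.2) t (Ico_subset_Icc_self ht))

theorem exists_oscillator_bound {a b : ℝ} (ha : 0 < a) (hb : 0 < b) :
    ∃ C : ℝ, 1 ≤ C ∧ ∀ (T : ℝ) (w φ : ℝ → ℝ),
      (∀ t ∈ Icc 0 T, ∃ d, HasDerivWithinAt w d (Icc 0 T) t ∧ a * d = -b * φ t) →
      (∀ t ∈ Icc 0 T, HasDerivWithinAt φ (w t) (Icc 0 T) t) →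
      ∀ r, |w 0| ≤ r → |φ 0| ≤ r → ∀ t ∈ Icc 0 T, |w t| ≤ C * r ∧ |φ t| ≤ C * r := by
  have hmin : 0 < min a b := lt_min ha hb
  -- Energy gives `y² ≤ K r²` with `K = (a + b) / min a b`; since `K ≤ (1 + K)²`, the constant `1 +
  -- K` avoids a square root. It does not depend on `T`.
  refine ⟨1 + (a + b) / min a b, by
    have : 0 < (a + b) / min a b := by positivity
    linarith, fun T w φ hw hφ r hw0 hφ0 t ht => ?_⟩
  have hE := oscillator_energy hw hφ t ht
  have hr : 0 ≤ r := (abs_nonneg _).trans hw0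
  have hC : 0 < (a + b) / min a b := by positivity
  have h0 : a * w 0 ^ 2 + b * φ 0 ^ 2 ≤ (a + b) * r ^ 2 := by
    have h1 := sq_le_sq' (abs_le.mp hw0).1 (abs_le.mp hw0).2
    have h2 := sq_le_sq' (abs_le.mp hφ0).1 (abs_le.mp hφ0).2
    nlinarith
  have key : ∀ x y : ℝ, min a b ≤ x → a * w t ^ 2 + b * φ t ^ 2 ≥ x * y ^ 2 →
      |y| ≤ (1 + (a + b) / min a b) * r := fun x y hx hy => by
    apply abs_le_of_sq_le_sq _ (by positivity)
    have : y ^ 2 ≤ (a + b) / min a b * r ^ 2 := by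
      rw [div_mul_eq_mul_div, le_div_iff₀ hmin]
      nlinarith [mul_le_mul_of_nonneg_right hx (sq_nonneg y)]
    nlinarith [mul_nonneg hC.le (sq_nonneg r), sq_nonneg ((a + b) / min a b * r), sq_nonneg r]
  constructor
  · exact key a (w t) (min_le_left a b) (by nlinarith [mul_nonneg hb.le (sq_nonneg (φ t))])
  · exact key b (φ t) (min_le_right a b) (by nlinarith [mul_nonneg ha.le (sq_nonneg (w t))])

theorem eq_of_hasDerivWithinAt_zero {T : ℝ} {y : ℝ → ℝ}
    (hy : ∀ t ∈ Icc 0 T, HasDerivWithinAt y 0 (Icc 0 T) t) : ∀ t ∈ Icc 0 T, y t = y 0 :=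
  constant_of_derivWithin_zero (fun t ht => (hy t ht).differentiableWithinAt) fun t ht =>
    (hy t (Ico_subset_Icc_self ht)).derivWithin
      (uniqueDiffOn_Icc (ht.1.trans_lt ht.2) t (Ico_subset_Icc_self ht))

section Stability

variable {E : Type*} [NormedAddCommGroup E] [NormedSpace ℝ E]

theorem lyapunovStable_of_norm_le {F : E → Set E} {C : ℝ} (hC : 1 ≤ C)
    (h : ∀ T z, IsSolution F T z → ∀ t ∈ Icc 0 T, ‖z t‖ ≤ C * ‖z 0‖) : LyapunovStable F := by
  have hC0 : 0 < C := by linarith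
  refine fun ε hε => ⟨ε / C, by positivity, fun T z hz h0 t ht => (h T z hz t ht).trans_lt ?_⟩
  rwa [lt_div_iff₀ hC0, mul_comm] at h0

/-- A line of equilibria through the origin prevents attractivity. -/
theorem not_attractive_of_equilibria {F : E → Set E} {e : E} (he : e ≠ 0)
    (h : ∀ c : ℝ, 0 ∈ F (c • e)) : ¬ Attractive F := by
  rintro ⟨δ, hδ, hattr⟩
  have hn : 0 < ‖e‖ := norm_pos_iff.mpr he
  have hlim := hattr (fun _ => (δ / 2 / ‖e‖) • e)
    (fun T t _ => ⟨0, h _, hasDerivWithinAt_const ..⟩) (by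
      rw [norm_smul, Real.norm_of_nonneg (by positivity), div_mul_cancel₀ _ hn.ne']
      linarith)
  have := tendsto_nhds_unique hlim tendsto_const_nhds
  rw [eq_comm, smul_eq_zero] at this
  exact this.elim (fun h => by have : 0 < δ / 2 / ‖e‖ := by positivity
                               linarith) he

end Stability

theorem Params.marginallyStable_linearized_zeroDyn {P : Params} (hg : 0 < P.g) (hm : P.mtot ≠ 0)
    (hH : IsUnit P.HCoG.det) (hα : 0 < P.α) :
    MarginallyStable (ode (fun z : Fin 5 → ℝ => fderiv ℝ P.zeroDyn 0 z)) := by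
  have hJ : ∀ z : Fin 5 → ℝ, fderiv ℝ P.zeroDyn 0 z =
      ![-P.g / P.α * z 2, -P.g / P.α * z 3, z 0, z 1, 0] := fun z => by
    rw [(hasFDerivAt_zeroDyn hm hH hα.ne').fderiv]
    ext i
    fin_cases i <;> simp [zeroDynJacobian, Matrix.mulVec, dotProduct, Fin.sum_univ_five]
  obtain ⟨C, hC, hosc⟩ := exists_oscillator_bound hα hg
  refine ⟨lyapunovStable_of_norm_le hC fun T z hz t ht => ?_,
    not_attractive_of_equilibria (e := ![0, 0, 0, 0, 1]) (fun h => by simpa using congrFun h 4)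
      fun c => ?_⟩
  · have hz' : ∀ t ∈ Icc 0 T, ∀ i, HasDerivWithinAt (fun t => z t i)
        ((![-P.g / P.α * z t 2, -P.g / P.α * z t 3, z t 0, z t 1, 0] : Fin 5 → ℝ) i)
        (Icc 0 T) t := fun t ht => by
      obtain ⟨v, rfl, hv⟩ := hz t ht
      simp only [hJ] at hv
      exact hasDerivWithinAt_pi.mp hv
    have h0 : ∀ i, |z 0 i| ≤ ‖z 0‖ := norm_le_pi_norm (z 0)
    have hx := hosc T (fun t => z t 0) (fun t => z t 2)
      (fun t ht => ⟨_, hz' t ht 0, by simp; field_simp⟩) (fun t ht => hz' t ht 2)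
      ‖z 0‖ (h0 0) (h0 2) t ht
    have hy := hosc T (fun t => z t 1) (fun t => z t 3)
      (fun t ht => ⟨_, hz' t ht 1, by simp; field_simp⟩) (fun t ht => hz' t ht 3)
      ‖z 0‖ (h0 1) (h0 3) t ht
    have hψ : z t 4 = z 0 4 := eq_of_hasDerivWithinAt_zero (fun t ht => hz' t ht 4) t ht
    rw [pi_norm_le_iff_of_nonneg (by positivity)]
    intro i
    fin_cases i
    · exact hx.1
    · exact hy.1
    · exact hx.2
    · exact hy.2
    · change |z t 4| ≤ _
      rw [hψ]
      exact (h0 4).trans (le_mul_of_one_le_left (norm_nonneg _) hC)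
  · change 0 = fderiv ℝ P.zeroDyn 0 (c • ![0, 0, 0, 0, 1])
    rw [hJ]
    ext i
    fin_cases i <;> simp

/-! ### Differentiability of the model -/

section Entrywise

variable {E : Type*} [NormedAddCommGroup E] [NormedSpace ℝ E] {l m n : Type*} [Fintype n]

theorem differentiableAt_mulVec {A : E → Matrix m n ℝ} {u : E → n → ℝ} {x : E}
    (hA : ∀ i j, DifferentiableAt ℝ (fun q => A q i j) x)
    (hu : ∀ j, DifferentiableAt ℝ (fun q => u q j) x) (i : m) :
    DifferentiableAt ℝ (fun q => (A q *ᵥ u q) i) x := by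
  simp only [Matrix.mulVec, dotProduct]
  exact DifferentiableAt.fun_sum fun j _ => (hA i j).mul (hu j)

theorem differentiableAt_matrix_mul {A : E → Matrix l n ℝ} {B : E → Matrix n m ℝ} {x : E}
    (hA : ∀ i j, DifferentiableAt ℝ (fun q => A q i j) x)
    (hB : ∀ i j, DifferentiableAt ℝ (fun q => B q i j) x) (i : l) (j : m) :
    DifferentiableAt ℝ (fun q => (A q * B q) i j) x := by
  simp only [Matrix.mul_apply]
  exact DifferentiableAt.fun_sum fun k _ => (hA i k).mul (hB k j)

/-- The term `A' u` of the product rule vanishes with `u t`, so the derivative of `A` is never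
computed. At hover this applies with the accelerations or `ω` as `u`. -/
theorem hasDerivAt_mulVec_of_eq_zero {A : ℝ → Matrix m n ℝ} {u : ℝ → n → ℝ} {u' : n → ℝ} {t : ℝ}
    (hA : ∀ i j, DifferentiableAt ℝ (fun s => A s i j) t)
    (hu : ∀ j, HasDerivAt (fun s => u s j) (u' j) t) (h0 : u t = 0) (i : m) :
    HasDerivAt (fun s => (A s *ᵥ u s) i) ((A t *ᵥ u') i) t := by
  simp only [Matrix.mulVec, dotProduct]
  refine HasDerivAt.fun_sum fun j _ => ((hA i j).hasDerivAt.mul (hu j)).congr_deriv ?_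
  simp [h0]

end Entrywise

theorem contDiff_rot_apply (i j : Fin 3) : ContDiff ℝ 2 fun η : V3 => rot η i j := by
  simp only [rot_apply]
  fin_cases i <;> fin_cases j <;> simp <;> fun_prop

/-- As a value of the Fréchet derivative of a `C²` function, the partial derivative is visibly
differentiable in `η`. -/
theorem rotPartials_apply (η : V3) (k : Fin 3 × Fin 3) (b : Fin 3) :
    rotPartials η k b = fderiv ℝ (fun η : V3 => rot η k.2 b) η (Pi.single k.1 1) := by
  have hd := ((contDiff_rot_apply k.2 b).differentiable two_ne_zero η).hasFDerivAt
  exact (hd.comp_hasDerivAt_of_eq (η k.1) (hasDerivAt_update η k.1 (η k.1))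
    (Function.update_eq_self k.1 η).symm).deriv

theorem differentiable_rotPartials_apply (k : Fin 3 × Fin 3) (b : Fin 3) :
    Differentiable ℝ fun η : V3 => rotPartials η k b := by
  simp only [rotPartials_apply]
  have h := (contDiff_rot_apply k.2 b).fderiv_right (m := 1) (by norm_num)
  exact (h.differentiable one_ne_zero).clm_apply (differentiable_const _)

theorem Gam_mulVec_e3 (η : V3) : Gam η *ᵥ e3 =
    ![-Real.sin (η 1), Real.sin (η 0) * Real.cos (η 1), Real.cos (η 0) * Real.cos (η 1)] := by
  ext i
  fin_cases i <;> simp [Gam, e3, Matrix.mulVec, dotProduct, Fin.sum_univ_three]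

theorem differentiable_Gam_apply (i j : Fin 3) : Differentiable ℝ fun η : V3 => Gam η i j := by
  fin_cases i <;> fin_cases j <;> simp [Gam] <;> fun_prop

theorem differentiableAt_Gam_inv_apply {η : V3} (h : Real.cos (η 1) ≠ 0) (i j : Fin 3) :
    DifferentiableAt ℝ (fun η : V3 => (Gam η)⁻¹ i j) η := by
  simp only [Matrix.inv_def, det_Gam, Ring.inverse_eq_inv', Matrix.smul_apply, smul_eq_mul]
  refine DifferentiableAt.mul (by fun_prop (disch := assumption)) ?_
  simp only [Gam, Matrix.adjugate_fin_three_of]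
  fin_cases i <;> fin_cases j <;> simp <;> fun_prop

theorem differentiable_skew_apply (i j : Fin 3) : Differentiable ℝ fun a : V3 => skew a i j := by
  fin_cases i <;> fin_cases j <;> simp [skew] <;> fun_prop

namespace Params

variable {P : Params}

/-- Replaces the state-dependent inverse of `By` by the constant `HCoG⁻¹`, so that differentiability
follows termwise. -/
theorem accel_inr_eq (hm : P.mtot ≠ 0) (hH : IsUnit P.HCoG.det) (v ω η : V3) (F : Input) :
    P.accel v ω η F ∘ Sum.inr = P.HCoG⁻¹ *ᵥ (Matrix.vecTail F -
      (P.mtot • (P.M2 ω *ᵥ ((rot η)ᵀ *ᵥ v)) + (skew ω *ᵥ (P.M1 *ᵥ ω) - P.M3 v η *ᵥ ω) +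
        (P.mtot * P.g) • ((skew P.rhat)ᵀ *ᵥ (Gam η *ᵥ e3))) -
      (skew P.rhat)ᵀ *ᵥ ((rot η)ᵀ *ᵥ (F 0 • (rot η *ᵥ e3) -
        (P.mtot • (rot η *ᵥ (skew ω *ᵥ (skew P.rhat *ᵥ ω))) + (P.mtot * P.g) • e3)))) := by
  rw [← (accel_equations hm hH v ω η F).2, Matrix.mulVec_mulVec, Matrix.nonsing_inv_mul _ hH,
    Matrix.one_mulVec]

theorem accel_inl_eq (hm : P.mtot ≠ 0) (hH : IsUnit P.HCoG.det) (v ω η : V3) (F : Input) :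
    P.accel v ω η F ∘ Sum.inl = P.mtot⁻¹ • (F 0 • (rot η *ᵥ e3) -
        (P.mtot • (rot η *ᵥ (skew ω *ᵥ (skew P.rhat *ᵥ ω))) + (P.mtot * P.g) • e3)) -
      rot η *ᵥ (skew P.rhat *ᵥ (P.accel v ω η F ∘ Sum.inr)) := by
  rw [← (accel_equations hm hH v ω η F).1, inv_smul_smul₀ hm, add_sub_cancel_right]

theorem differentiableAt_model (hm : P.mtot ≠ 0) (hH : IsUnit P.HCoG.det) {q : State × Input}
    (hq : Real.cos (q.1.2.2.2 1) ≠ 0) : DifferentiableAt ℝ P.model q := by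
  have hv : ∀ i, DifferentiableAt ℝ (fun q : State × Input => q.1.1 i) q := fun i => by fun_prop
  have hω : ∀ i, DifferentiableAt ℝ (fun q : State × Input => q.1.2.1 i) q := fun i => by fun_prop
  have hF : ∀ i, DifferentiableAt ℝ (fun q : State × Input => q.2 i) q := fun i => by fun_prop
  have hωv : DifferentiableAt ℝ (fun q : State × Input => q.1.2.1) q := by fun_prop
  have hη : DifferentiableAt ℝ (fun q : State × Input => q.1.2.2.2) q := by fun_prop
  have hR : ∀ i j, DifferentiableAt ℝ (fun q : State × Input => rot q.1.2.2.2 i j) q := fun i j =>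
    DifferentiableAt.comp q ((contDiff_rot_apply i j).differentiable two_ne_zero _) hη
  have hRt : ∀ i j, DifferentiableAt ℝ (fun q : State × Input => (rot q.1.2.2.2)ᵀ i j) q :=
    fun i j => hR j i
  have hRp : ∀ k b, DifferentiableAt ℝ (fun q : State × Input => rotPartials q.1.2.2.2 k b) q :=
    fun k b => DifferentiableAt.comp q (differentiable_rotPartials_apply k b _) hη
  have hG : ∀ i j, DifferentiableAt ℝ (fun q : State × Input => Gam q.1.2.2.2 i j) q := fun i j =>
    DifferentiableAt.comp q (differentiable_Gam_apply i j _) hη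
  have hGi : ∀ i j, DifferentiableAt ℝ (fun q : State × Input => (Gam q.1.2.2.2)⁻¹ i j) q :=
    fun i j => DifferentiableAt.comp (g := fun η => (Gam η)⁻¹ i j) q
      (differentiableAt_Gam_inv_apply hq i j) hη
  have hS : ∀ i j, DifferentiableAt ℝ (fun q : State × Input => skew q.1.2.1 i j) q := fun i j =>
    DifferentiableAt.comp q (differentiable_skew_apply i j _) hωv
  have hconst : ∀ {m n : Type} (A : Matrix m n ℝ) (i : m) (j : n),
      DifferentiableAt ℝ (fun _ : State × Input => A i j) q := fun A i j => by fun_prop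
  have he : ∀ i, DifferentiableAt ℝ (fun _ : State × Input => e3 i) q := fun i => by fun_prop
  have hM2 : ∀ i j, DifferentiableAt ℝ (fun q : State × Input => P.M2 q.1.2.1 i j) q := fun i j =>
    (differentiableAt_matrix_mul (hconst _) hS i j).sub
      (differentiableAt_matrix_mul hS (hconst _) i j)
  have hM3 : ∀ i j, DifferentiableAt ℝ (fun q : State × Input => P.M3 q.1.1 q.1.2.2.2 i j) q :=
    fun i j => by
      simp only [M3, Matrix.smul_apply, smul_eq_mul]
      refine DifferentiableAt.const_mul (differentiableAt_matrix_mul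
        (differentiableAt_matrix_mul (fun i k => ?_) hRp) (hconst _) i j) _
      simp only [Matrix.of_apply, Matrix.transpose_apply]
      exact (hGi k.1 i).mul (hv k.2)
  have hb : ∀ i, DifferentiableAt ℝ (fun q : State × Input =>
      (q.2 0 • (rot q.1.2.2.2 *ᵥ e3) - (P.mtot • (rot q.1.2.2.2 *ᵥ
        (skew q.1.2.1 *ᵥ (skew P.rhat *ᵥ q.1.2.1))) + (P.mtot * P.g) • e3)) i) q := fun i =>
    ((hF 0).mul (differentiableAt_mulVec hR he i)).sub
      (((differentiableAt_mulVec hR (differentiableAt_mulVec hS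
        (differentiableAt_mulVec (hconst _) hω)) i).const_mul P.mtot).add
        ((he i).const_mul (P.mtot * P.g)))
  have hw : ∀ i, DifferentiableAt ℝ (fun q : State × Input =>
      (P.accel q.1.1 q.1.2.1 q.1.2.2.2 q.2 ∘ Sum.inr) i) q := by
    simp only [accel_inr_eq hm hH]
    refine differentiableAt_mulVec (hconst _) fun i => ?_
    refine DifferentiableAt.sub (DifferentiableAt.sub (hF i.succ) ?_)
      (differentiableAt_mulVec (hconst _) (differentiableAt_mulVec hRt hb) i)
    refine (((differentiableAt_mulVec hM2 (differentiableAt_mulVec hRt hv) i).const_mul _).add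
      ((differentiableAt_mulVec hS (differentiableAt_mulVec (hconst _) hω) i).sub
        (differentiableAt_mulVec hM3 hω i))).add ?_
    exact (differentiableAt_mulVec (hconst _) (differentiableAt_mulVec hG he) i).const_mul _
  have ha : ∀ i, DifferentiableAt ℝ (fun q : State × Input =>
      (P.accel q.1.1 q.1.2.1 q.1.2.2.2 q.2 ∘ Sum.inl) i) q := fun i => by
    simp only [accel_inl_eq hm hH]
    exact ((hb i).const_mul _).sub
      (differentiableAt_mulVec hR (differentiableAt_mulVec (hconst _) hw) i)
  exact (differentiableAt_pi.mpr ha).prodMk ((differentiableAt_pi.mpr hw).prodMk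
    ((differentiableAt_pi.mpr hv).prodMk (differentiableAt_pi.mpr (differentiableAt_mulVec hGi hω))))

/-! ### Hover equilibria and the linearized model -/

theorem accel_hover (P : Params) (ψ : ℝ) : P.accel 0 0 ![0, 0, ψ] P.hoverInput = 0 := by
  have hR : rot ![0, 0, ψ] *ᵥ e3 = e3 := by
    rw [rot_apply]
    ext i
    fin_cases i <;> simp [e3, Matrix.mulVec, dotProduct, Fin.sum_univ_three]
  have hG : Gam ![0, 0, ψ] *ᵥ e3 = e3 := by
    rw [Gam_mulVec_e3]
    ext i
    fin_cases i <;> simp [e3]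
  rw [accel, MF_mulVec, M5_eq, hR, hG]
  simp [hoverInput]

theorem accel_zero_hoverInput (P : Params) : P.accel 0 0 0 P.hoverInput = 0 := by
  have h : (![0, 0, 0] : V3) = 0 := by ext i; fin_cases i <;> rfl
  have ha := P.accel_hover 0
  rwa [h] at ha

theorem model_hover (P : Params) (p : V3) (ψ : ℝ) :
    P.model ((0, 0, p, ![0, 0, ψ]), P.hoverInput) = 0 := by
  simp only [model, accel_hover, Matrix.mulVec_zero]
  rfl

theorem model_zero_hoverInput (P : Params) : P.model (0, P.hoverInput) = 0 := by
  have h : (![0, 0, 0] : V3) = 0 := by ext i; fin_cases i <;> rfl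
  have hm := P.model_hover 0 0
  rwa [h] at hm

theorem hasLineDerivAt_model (hm : P.mtot ≠ 0) (hH : IsUnit P.HCoG.det) (h : State × Input) :
    HasLineDerivAt ℝ P.model (fderiv ℝ P.model (0, P.hoverInput) h) (0, P.hoverInput) h :=
  (differentiableAt_model hm hH (by simp)).hasFDerivAt.hasLineDerivAt h

/-- Hover is an equilibrium at every heading under the same input, so the model vanishes along the
whole yaw line. -/
theorem fderiv_model_yaw (hm : P.mtot ≠ 0) (hH : IsUnit P.HCoG.det) (c : ℝ) :
    fderiv ℝ P.model (0, P.hoverInput) (c • (0, 0, 0, ![0, 0, 1]), 0) = 0 := by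
  refine (hasLineDerivAt_model hm hH _).unique ?_
  have : ∀ t : ℝ, P.model ((0, P.hoverInput) + t • (c • ((0, 0, 0, ![0, 0, 1]) : State), 0)) = 0 :=
    fun t => by
      convert P.model_hover 0 (t * c) using 2
      ext i <;> try fin_cases i
      all_goals simp
  exact (hasDerivAt_const (0 : ℝ) (0 : State)).congr_of_eventuallyEq (.of_forall this)

/-- The rows of the linearization at hover that involve neither torques nor thrust. -/
theorem fderiv_model_spec (hm : P.mtot ≠ 0) (hH : IsUnit P.HCoG.det) (x : State) (u : Input)
    {w : State} (hw : w = fderiv ℝ P.model (0, P.hoverInput) (x, u)) :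
    w.1 0 + (skew P.rhat *ᵥ w.2.1) 0 = P.g * x.2.2.2 1 ∧
    w.1 1 + (skew P.rhat *ᵥ w.2.1) 1 = -P.g * x.2.2.2 0 ∧
    w.2.2.1 = x.1 ∧ w.2.2.2 = x.2.1 := by
  have hl := hasLineDerivAt_model hm hH (x, u)
  rw [← hw] at hl
  obtain ⟨v, ω, p, η⟩ := x
  have hl' : HasDerivAt (fun t : ℝ => P.model ((t • v, t • ω, t • p, t • η), P.hoverInput + t • u))
      w 0 := by
    simpa [HasLineDerivAt] using hl
  have hη : ∀ i, HasDerivAt (fun t : ℝ => (t • η) i) (η i) 0 := fun i => by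
    simpa using (hasDerivAt_id (0 : ℝ)).mul_const (η i)
  have hω : ∀ i, HasDerivAt (fun t : ℝ => (t • ω) i) (ω i) 0 := fun i => by
    simpa using (hasDerivAt_id (0 : ℝ)).mul_const (ω i)
  have h1 : HasDerivAt (fun t : ℝ =>
      P.accel (t • v) (t • ω) (t • η) (P.hoverInput + t • u) ∘ Sum.inl) w.1 0 := hl'.fst
  have h2 : HasDerivAt (fun t : ℝ =>
      P.accel (t • v) (t • ω) (t • η) (P.hoverInput + t • u) ∘ Sum.inr) w.2.1 0 := hl'.snd.fst
  have h3 : HasDerivAt (fun t : ℝ => t • v) w.2.2.1 0 := hl'.snd.snd.fst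
  have h4 : HasDerivAt (fun t : ℝ => (Gam (t • η))⁻¹ *ᵥ (t • ω)) w.2.2.2 0 := hl'.snd.snd.snd
  have hzero : P.accel ((0 : ℝ) • v) ((0 : ℝ) • ω) ((0 : ℝ) • η) (P.hoverInput + (0 : ℝ) • u) = 0 := by
    simpa using P.accel_zero_hoverInput
  -- The balance identity is differentiated along the line instead of `accel` itself; the input
  -- perturbation enters it only along `e3`.
  have hbal := fun t : ℝ => body_force_balance hm hH (t • v) (t • ω) (t • η) (P.hoverInput + t • u)
  have hlhs : ∀ i, HasDerivAt (fun t : ℝ =>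
      ((rot (t • η))ᵀ *ᵥ (P.accel (t • v) (t • ω) (t • η) (P.hoverInput + t • u) ∘ Sum.inl) +
        skew P.rhat *ᵥ (P.accel (t • v) (t • ω) (t • η) (P.hoverInput + t • u) ∘ Sum.inr)) i)
      (w.1 i + (skew P.rhat *ᵥ w.2.1) i) 0 := fun i => by
    have hrot0 : rot ((0 : ℝ) • η) = 1 := by
      rw [rot_apply]
      ext i j
      fin_cases i <;> fin_cases j <;> simp
    refine HasDerivAt.add ?_ ?_
    · have := hasDerivAt_mulVec_of_eq_zero (A := fun t : ℝ => (rot (t • η))ᵀ)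
        (fun i j => DifferentiableAt.comp (0 : ℝ)
          ((contDiff_rot_apply j i).differentiable two_ne_zero _) (by fun_prop))
        (hasDerivAt_pi.mp h1) (by rw [hzero]; rfl) i
      rwa [hrot0, Matrix.transpose_one, Matrix.one_mulVec] at this
    · exact hasDerivAt_mulVec_of_eq_zero (A := fun _ : ℝ => skew P.rhat)
        (fun i j => by fun_prop) (hasDerivAt_pi.mp h2)
        (by rw [hzero]; rfl) i
  simp only [hbal] at hlhs
  have hquad : ∀ i, HasDerivAt (fun t : ℝ =>
      (skew (t • ω) *ᵥ (skew P.rhat *ᵥ (t • ω))) i) 0 0 := fun i => by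
    have := hasDerivAt_mulVec_of_eq_zero (A := fun t : ℝ => skew (t • ω) * skew P.rhat)
      (fun i j => differentiableAt_matrix_mul (fun i j => DifferentiableAt.comp (0 : ℝ)
        (differentiable_skew_apply i j _) (by fun_prop)) (fun i j => by fun_prop) i j)
      hω (zero_smul ℝ ω) i
    have hskew0 : skew 0 = 0 := by
      ext i j
      fin_cases i <;> fin_cases j <;> simp [skew]
    simpa [← Matrix.mulVec_mulVec, hskew0] using this
  refine ⟨?_, ?_, ?_, ?_⟩
  · refine (hlhs 0).unique ?_
    have := ((hquad 0).neg).add ((hη 1).sin.const_mul P.g)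
    refine (this.congr_of_eventuallyEq (.of_forall fun t => ?_)).congr_deriv (by simp)
    simp only [Gam_mulVec_e3, Pi.sub_apply, Pi.add_apply, Pi.neg_apply, Pi.smul_apply,
      smul_eq_mul]
    simp [-Matrix.mulVec_mulVec, e3]
  · refine (hlhs 1).unique ?_
    have := ((hquad 1).neg).sub (((hη 0).sin.mul (hη 1).cos).const_mul P.g)
    refine (this.congr_of_eventuallyEq (.of_forall fun t => ?_)).congr_deriv (by simp)
    simp only [Gam_mulVec_e3, Pi.sub_apply, Pi.add_apply, Pi.neg_apply, Pi.smul_apply,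
      Pi.mul_apply, smul_eq_mul]
    simp [-Matrix.mulVec_mulVec, e3]
  · refine h3.unique ?_
    simpa using (hasDerivAt_id (0 : ℝ)).smul_const v
  · have hcos : Real.cos (((0 : ℝ) • η) 1) ≠ 0 := by simp
    have := hasDerivAt_pi.mpr (hasDerivAt_mulVec_of_eq_zero (A := fun t : ℝ => (Gam (t • η))⁻¹)
      (fun i j => DifferentiableAt.comp (g := fun η => (Gam η)⁻¹ i j) (0 : ℝ)
        (differentiableAt_Gam_inv_apply hcos i j) (by fun_prop)) hω (zero_smul ℝ ω))
    refine h4.unique (this.congr_deriv ?_)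
    rw [Gam_inv_mulVec _ _ hcos]
    ext i
    fin_cases i <;> simp

/-! ### Zero-output dynamics of the linearized model -/

theorem constrainedLinearization_norm_le (hm : P.mtot ≠ 0) (hH : IsUnit P.HCoG.det) {C T : ℝ}
    (hC : 1 ≤ C) (hT : 0 < T) {x : ℝ → State}
    (hosc : ∀ w φ : ℝ → ℝ,
      (∀ t ∈ Icc 0 T, ∃ d, HasDerivWithinAt w d (Icc 0 T) t ∧ P.α * d = -P.g * φ t) →
      (∀ t ∈ Icc 0 T, HasDerivWithinAt φ (w t) (Icc 0 T) t) →
      ∀ r, |w 0| ≤ r → |φ 0| ≤ r → ∀ t ∈ Icc 0 T, |w t| ≤ C * r ∧ |φ t| ≤ C * r)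
    (hx : IsSolution P.constrainedLinearization T x) :
    ∀ t ∈ Icc 0 T, ‖x t‖ ≤ C * ‖x 0‖ := by
  have huniq : ∀ t ∈ Icc 0 T, UniqueDiffWithinAt ℝ (Icc 0 T) t := uniqueDiffOn_Icc hT
  have hout : ∀ t ∈ Icc 0 T, OutputZero (x t) := fun t ht => by
    obtain ⟨w, ⟨h, -⟩, -⟩ := hx t ht
    exact h
  choose! w hw hd using hx
  have hspec : ∀ t ∈ Icc 0 T, _ := fun t ht =>
    fderiv_model_spec hm hH (x t) (hw t ht).2.choose (hw t ht).2.choose_spec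
  -- Hidden constraints: differentiating `p = 0` twice and `ω_z = 0` once in time gives `p' = 0`,
  -- `p'' = 0` and `ω_z' = 0`, whatever the input.
  have hv : ∀ t ∈ Icc 0 T, (x t).1 = 0 := fun t ht => by
    rw [← (hspec t ht).2.2.1]
    exact (huniq t ht).eq_deriv _ (hd t ht).snd.snd.fst
      ((hasDerivWithinAt_const t _ 0).congr (fun s hs => (hout s hs).1) (hout t ht).1)
  have hv' : ∀ t ∈ Icc 0 T, (w t).1 = 0 := fun t ht =>
    (huniq t ht).eq_deriv _ (hd t ht).fst
      ((hasDerivWithinAt_const t _ 0).congr (fun s hs => hv s hs) (hv t ht))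
  have hωd : ∀ t ∈ Icc 0 T, ∀ i,
      HasDerivWithinAt (fun t => (x t).2.1 i) ((w t).2.1 i) (Icc 0 T) t := fun t ht =>
    hasDerivWithinAt_pi.mp (hd t ht).snd.fst
  have hηd : ∀ t ∈ Icc 0 T, ∀ i,
      HasDerivWithinAt (fun t => (x t).2.2.2 i) ((x t).2.1 i) (Icc 0 T) t := fun t ht => by
    rw [← (hspec t ht).2.2.2]
    exact hasDerivWithinAt_pi.mp (hd t ht).snd.snd.snd
  have hωz : ∀ t ∈ Icc 0 T, (w t).2.1 2 = 0 := fun t ht =>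
    (huniq t ht).eq_deriv _ (hωd t ht 2)
      ((hasDerivWithinAt_const t _ 0).congr (fun s hs => (hout s hs).2) (hout t ht).2)
  have hpitch : ∀ t ∈ Icc 0 T, P.α * (w t).2.1 1 = -P.g * (x t).2.2.2 1 := fun t ht => by
    have := (hspec t ht).1
    simp [skew_mulVec, hv' t ht, hωz t ht, rhat_two] at this
    linarith
  have hroll : ∀ t ∈ Icc 0 T, P.α * (w t).2.1 0 = -P.g * (x t).2.2.2 0 := fun t ht => by
    have := (hspec t ht).2.1
    simp [skew_mulVec, hv' t ht, hωz t ht, rhat_two] at this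
    linarith
  have hyaw : ∀ t ∈ Icc 0 T, (x t).2.2.2 2 = (x 0).2.2.2 2 :=
    eq_of_hasDerivWithinAt_zero fun t ht => by
      have := hηd t ht 2
      rwa [(hout t ht).2] at this
  intro t ht
  have hω0 : ∀ i, |(x 0).2.1 i| ≤ ‖x 0‖ := fun i =>
    (norm_le_pi_norm (x 0).2.1 i).trans ((norm_fst_le _).trans (norm_snd_le _))
  have hη0 : ∀ i, |(x 0).2.2.2 i| ≤ ‖x 0‖ := fun i =>
    (norm_le_pi_norm (x 0).2.2.2 i).trans
      ((norm_snd_le _).trans ((norm_snd_le _).trans (norm_snd_le _)))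
  have h0 := hosc (fun t => (x t).2.1 0) (fun t => (x t).2.2.2 0)
    (fun t ht => ⟨_, hωd t ht 0, hroll t ht⟩) (fun t ht => hηd t ht 0) ‖x 0‖ (hω0 0) (hη0 0) t ht
  have h1 := hosc (fun t => (x t).2.1 1) (fun t => (x t).2.2.2 1)
    (fun t ht => ⟨_, hωd t ht 1, hpitch t ht⟩) (fun t ht => hηd t ht 1) ‖x 0‖ (hω0 1) (hη0 1) t ht
  have hCr : 0 ≤ C * ‖x 0‖ := by positivity
  refine norm_prod_le_iff.mpr ⟨by simpa [hv t ht], norm_prod_le_iff.mpr ⟨?_,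
    norm_prod_le_iff.mpr ⟨by simpa [(hout t ht).1], ?_⟩⟩⟩
  · rw [pi_norm_le_iff_of_nonneg hCr]
    intro i
    fin_cases i
    · exact h0.1
    · exact h1.1
    · simpa [(hout t ht).2]
  · rw [pi_norm_le_iff_of_nonneg hCr]
    intro i
    fin_cases i
    · exact h0.2
    · exact h1.2
    · change |(x t).2.2.2 2| ≤ _
      rw [hyaw t ht]
      exact (hη0 2).trans (le_mul_of_one_le_left (norm_nonneg _) hC)

theorem marginallyStable_constrainedLinearization (hg : 0 < P.g) (hm : P.mtot ≠ 0)
    (hH : IsUnit P.HCoG.det) (hα : 0 ≤ P.α) : MarginallyStable P.constrainedLinearization := by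
  obtain ⟨C, hC, hosc⟩ : ∃ C : ℝ, 1 ≤ C ∧ ∀ T : ℝ, 0 < T → ∀ w φ : ℝ → ℝ,
      (∀ t ∈ Icc 0 T, ∃ d, HasDerivWithinAt w d (Icc 0 T) t ∧ P.α * d = -P.g * φ t) →
      (∀ t ∈ Icc 0 T, HasDerivWithinAt φ (w t) (Icc 0 T) t) →
      ∀ r, |w 0| ≤ r → |φ 0| ≤ r → ∀ t ∈ Icc 0 T, |w t| ≤ C * r ∧ |φ t| ≤ C * r := by
    rcases hα.eq_or_lt with h0 | hpos
    -- For `α = 0` the oscillator equation forces `φ = 0`, and then `w = φ' = 0`.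
    · refine ⟨1, le_rfl, fun T hT w φ hw hφ r hw0 _ t ht => ?_⟩
      have hφ0 : ∀ t ∈ Icc 0 T, φ t = 0 := fun t ht => by
        obtain ⟨d, -, hd⟩ := hw t ht
        simpa [← h0, hg.ne'] using hd
      have hwt : w t = 0 := (uniqueDiffOn_Icc hT t ht).eq_deriv _ (hφ t ht)
        ((hasDerivWithinAt_const t _ 0).congr hφ0 (hφ0 t ht))
      have hr : 0 ≤ 1 * r := by simpa using (abs_nonneg _).trans hw0
      simpa [hwt, hφ0 t ht] using hr
    · obtain ⟨C, hC, h⟩ := exists_oscillator_bound hpos hg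
      exact ⟨C, hC, fun T _ => h T⟩
  refine ⟨lyapunovStable_of_norm_le hC fun T x hx t ht => ?_,
    not_attractive_of_equilibria (e := (0, 0, 0, ![0, 0, 1])) (fun h => ?_) fun c => ⟨?_, 0, ?_⟩⟩
  -- On the one-point interval derivatives are not unique and the hidden constraints are lost, but
  -- the bound is trivial there.
  · rcases (ht.1.trans ht.2).eq_or_lt with rfl | hT
    · rw [le_antisymm ht.2 ht.1]
      exact le_mul_of_one_le_left (norm_nonneg _) hC
    · exact constrainedLinearization_norm_le hm hH hC hT (hosc T hT) hx t ht
  · simpa using congrFun (congrArg (fun y : State => y.2.2.2) h) 2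
  · simp [OutputZero]
  · exact (fderiv_model_yaw hm hH c).symm

end Params

end UAVPayload

theorem theorem1 (P : UAVPayload.Params) (hg : 0 < P.g) (hmU : 0 < P.mUAV) (hmP : 0 ≤ P.mPL)
    (hHU : P.HUAV.PosDef) (hHP : P.HPL.PosSemidef) :
    -- the zero dynamics are well defined for `α ≠ 0`; equilibrium, Jacobian and eigenvalues
    (P.α ≠ 0 →
      (∀ η : UAVPayload.V3, IsUnit (P.M4 η * UAVPayload.MF η).det) ∧
      P.zeroDyn 0 = 0 ∧
      HasFDerivAt P.zeroDyn
        (LinearMap.toContinuousLinearMap (Matrix.mulVecLin P.zeroDynJacobian)) 0 ∧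
      ∀ s : ℂ, s ^ 2 = ((-P.g / P.α : ℝ) : ℂ) →
        (P.zeroDynJacobian.map (fun r : ℝ => (r : ℂ))).charpoly.roots = {0, s, s, -s, -s}) ∧
    -- instability of the nonlinear zero dynamics
    (P.α < 0 → UAVPayload.Unstable (UAVPayload.ode P.zeroDyn)) ∧
    -- marginal stability of the linearized zero dynamics
    (0 < P.α →
      UAVPayload.MarginallyStable
        (UAVPayload.ode (fun z : Fin 5 → ℝ => fderiv ℝ P.zeroDyn 0 z))) ∧
    -- the same, as zero-output dynamics of the linearized model, with `α = 0` included
    P.model (0, P.hoverInput) = 0 ∧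
    DifferentiableAt ℝ P.model (0, P.hoverInput) ∧
    (0 ≤ P.α → UAVPayload.MarginallyStable P.constrainedLinearization) := by
  have hm : P.mtot ≠ 0 := (UAVPayload.Params.mtot_pos hmU hmP).ne'
  have hH : IsUnit P.HCoG.det := UAVPayload.Params.isUnit_HCoG hmU hmP hHU hHP
  refine ⟨fun hα => ?_, UAVPayload.Params.unstable_zeroDyn hg hm hH,
    UAVPayload.Params.marginallyStable_linearized_zeroDyn hg hm hH, P.model_zero_hoverInput,
    UAVPayload.Params.differentiableAt_model hm hH (by simp),
    UAVPayload.Params.marginallyStable_constrainedLinearization hg hm hH⟩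
  refine ⟨UAVPayload.Params.isUnit_det_M4_mul_MF hm hH hα, ?_,
    UAVPayload.Params.hasFDerivAt_zeroDyn hm hH hα, P.roots_charpoly_zeroDynJacobian⟩
  rw [UAVPayload.Params.zeroDyn_eq hm hH hα 0 (by simp)]
  ext i
  fin_cases i <;> simp
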